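/- Let $k$ be a commutative Artinian ring and let $R$ be an Artin $k$-algebra, that is, a $k$-algebra which is finitely generated as a $k$-module. Let $\operatorname{Mod} R$ be the category of left $R$-modules and $\operatorname{mod} R$ the full subcategory of finitely generated ones. For $M\in\operatorname{Mod} R$ let $0\to M\to E^0(M)\to E^1(M)\to\cdots$ be a minimal injective coresolution of $M$. For $s\ge 0$ let $\mathscr{G}_\infty(s)$ be the class of all $M\in\operatorname{Mod} R$ such that the flat dimension of $E^i(M)$ is at most $s+i$ for every $i\ge 0$, and let $\mathscr{P}^s(\operatorname{Mod} R)$ (resp. $\mathscr{P}^s(\operatorname{mod} R)$) be the class of all modules in $\operatorname{Mod} R$ (resp. $\operatorname{mod} R$) of projective dimension at most $s$; in particular $\mathscr{P}^0$ is the class of projective modules. A left and right Noetherian ring is called Auslander-regular if ${}_RR\in\mathscr{G}_\infty(0)$ (the Auslander condition) and its global dimension is finite. Then the following statements are equivalent. (1) $R$ is Auslander-regular. (2) $\mathscr{G}_\infty(0)=\mathscr{P}^0(\operatorname{Mod} R)$. (3) $\mathscr{G}_\infty(0)\cap\operatorname{mod} R=\mathscr{P}^0(\operatorname{mod} R)$.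 (4) $\mathscr{G}_\infty(s)=\mathscr{P}^s(\operatorname{Mod} R)$ for every $s\ge 0$. (5) $\mathscr{G}_\infty(s)\cap\operatorname{mod} R=\mathscr{P}^s(\operatorname{mod} R)$ for every $s\ge 0$. -/

import Mathlib

open CategoryTheory
open scoped TensorProduct MulOpposite

universe u v

noncomputable section

namespace AuslanderType

/-! ### Flat modules over a noncommutative ring

Mathlib's `Module.Flat` is restricted to commutative rings. Right `R`-modules are
`Rᵐᵒᵖ`-modules, with `n r = op r • n`. -/

section Flat

variable (R : Type u) [Ring R]

/-- The subgroup of `N ⊗[ℤ] M` generated by all `(n r) ⊗ m - n ⊗ (r m)`. -/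
def balancingRelations (N M : Type u) [AddCommGroup N] [Module Rᵐᵒᵖ N]
    [AddCommGroup M] [Module R M] : AddSubgroup (N ⊗[ℤ] M) :=
  AddSubgroup.closure
    {x | ∃ (n : N) (r : R) (m : M), x = (MulOpposite.op r • n) ⊗ₜ[ℤ] m - n ⊗ₜ[ℤ] (r • m)}

/-- The tensor product `N ⊗_R M` of a right `R`-module `N` and a left `R`-module `M`. -/
abbrev BalancedTensor (N M : Type u) [AddCommGroup N] [Module Rᵐᵒᵖ N]
    [AddCommGroup M] [Module R M] : Type u :=
  (N ⊗[ℤ] M) ⧸ balancingRelations R N M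

variable {R} in
theorem balancingRelations_le_comap {N N' : Type u} (M : Type u)
    [AddCommGroup N] [Module Rᵐᵒᵖ N] [AddCommGroup N'] [Module Rᵐᵒᵖ N']
    [AddCommGroup M] [Module R M] (f : N →ₗ[Rᵐᵒᵖ] N') :
    balancingRelations R N M ≤
      (balancingRelations R N' M).comap
        (LinearMap.rTensor M (f.restrictScalars ℤ)).toAddMonoidHom := by
  refine (AddSubgroup.closure_le _).2 ?_
  rintro _ ⟨n, r, m, rfl⟩
  refine AddSubgroup.subset_closure ⟨f n, r, m, ?_⟩
  simp

variable {R} in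
/-- The map `f ⊗_R M : N ⊗_R M → N' ⊗_R M` induced by a map `f : N → N'` of right modules. -/
def BalancedTensor.map {N N' : Type u} (M : Type u)
    [AddCommGroup N] [Module Rᵐᵒᵖ N] [AddCommGroup N'] [Module Rᵐᵒᵖ N']
    [AddCommGroup M] [Module R M] (f : N →ₗ[Rᵐᵒᵖ] N') :
    BalancedTensor R N M →+ BalancedTensor R N' M :=
  QuotientAddGroup.map _ _ (LinearMap.rTensor M (f.restrictScalars ℤ)).toAddMonoidHom
    (balancingRelations_le_comap M f)

/-- A left `R`-module `M` is flat if `- ⊗_R M` preserves injectivity of maps of right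
`R`-modules. -/
def IsFlat (M : Type u) [AddCommGroup M] [Module R M] : Prop :=
  ∀ ⦃N N' : Type u⦄ [AddCommGroup N] [Module Rᵐᵒᵖ N] [AddCommGroup N'] [Module Rᵐᵒᵖ N']
    (f : N →ₗ[Rᵐᵒᵖ] N'), Function.Injective f → Function.Injective (BalancedTensor.map M f)

end Flat

section Classes

variable (R : Type u) [Ring R]

/-- `FlatDimLE R n M`: the flat dimension of `M` is at most `n`, that is, there is an exact
sequence `0 → Fₙ → ⋯ → F₁ → F₀ → M → 0` with all `Fᵢ` flat; it is spliced here from short exact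
sequences `0 → ker p → F → M → 0`. -/
def FlatDimLE : ℕ → ModuleCat.{u} R → Prop
  | 0, M => IsFlat R M
  | n + 1, M => ∃ (F : ModuleCat.{u} R) (p : F →ₗ[R] M),
      IsFlat R F ∧ Function.Surjective p ∧ FlatDimLE n (ModuleCat.of R (LinearMap.ker p))

variable {R} in
/-- A submodule is essential if it meets every nonzero submodule nontrivially. -/
def IsEssential {E : Type u} [AddCommGroup E] [Module R E] (K : Submodule R E) : Prop :=
  ∀ L : Submodule R E, L ⊓ K = ⊥ → L = ⊥

variable {R} in
/-- A minimal injective coresolution `0 → M → E⁰ → E¹ → ⋯` of `M`: an exact sequence with all `Eⁱ`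
injective, in which `E⁰` is an injective envelope of `M` and `Eⁱ⁺¹` is an injective envelope of
the image of `Eⁱ → Eⁱ⁺¹`. -/
structure MinimalInjectiveCoresolution (M : ModuleCat.{u} R) where
  /-- the terms -/
  E : ℕ → ModuleCat.{u} R
  /-- the coaugmentation -/
  ι : M →ₗ[R] E 0
  /-- the differentials -/
  d : ∀ i : ℕ, E i →ₗ[R] E (i + 1)
  injective : ∀ i, Module.Injective R (E i)
  ι_injective : Function.Injective ι
  exact_zero : Function.Exact ι (d 0)
  exact_succ : ∀ i, Function.Exact (d i) (d (i + 1))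
  essential_zero : IsEssential (LinearMap.range ι)
  essential_succ : ∀ i, IsEssential (LinearMap.range (d i))

/-- The full subcategory `𝒢ₙ(m)` of `Mod R`: the modules `M` with `fd Eⁱ(M) ≤ m + i` for all
`0 ≤ i ≤ n - 1`, where `E•(M)` is a minimal injective coresolution of `M`. -/
def gClass (n m : ℕ) : ObjectProperty (ModuleCat.{u} R) := fun M =>
  ∃ C : MinimalInjectiveCoresolution M, ∀ i < n, FlatDimLE R (m + i) (C.E i)

/-- The full subcategory `𝒢_∞(m) = ⋂ₙ 𝒢ₙ(m)` of `Mod R`. -/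
def gInftyClass (m : ℕ) : ObjectProperty (ModuleCat.{u} R) := fun M =>
  ∀ n : ℕ, gClass R n m M

/-- The full subcategory `𝒫ˢ(Mod R)` of modules of projective dimension at most `s`. -/
def projDimLEClass (s : ℕ) : ObjectProperty (ModuleCat.{u} R) := fun M =>
  projectiveDimension M ≤ s

/-- The left global dimension: the supremum of the projective dimensions of all left modules. -/
def globalDimension : WithBot ℕ∞ :=
  ⨆ M : ModuleCat.{u} R, projectiveDimension M

/-- `R` satisfies the Auslander condition: `fd Eⁱ(R) ≤ i` for all `i`, for the left module `R`. -/
def AuslanderCondition : Prop :=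
  gInftyClass R 0 (ModuleCat.of R R)

/-- A left and right Noetherian ring is Auslander-regular if it satisfies the Auslander condition
and has finite global dimension. -/
structure IsAuslanderRegular : Prop where
  noetherian_left : IsNoetherianRing R
  noetherian_right : IsNoetherianRing Rᵐᵒᵖ
  auslander : AuslanderCondition R
  gldim_lt_top : globalDimension R < ⊤

end Classes

end AuslanderType

end

/-!
Over a semiprimary ring flat modules are projective, so `M ∈ 𝒢_∞(s)` means that the minimal
injective coresolution of `M` satisfies `pd Eⁱ ≤ s + i`; as its terms are direct summands of those
of any other injective coresolution, minimality can be dropped. Dimension shifting then gives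
`𝒢_∞(s) = 𝒫ˢ` whenever `R ∈ 𝒢_∞(0)` and `R` has finite global dimension.

Conversely, suppose that the finitely generated modules in `𝒢_∞(0)` are the projective ones. The
condition `R ∈ 𝒢_∞(0)` implies a dual one: modules of injective dimension at most `i` are
quotients of projective modules of injective dimension at most `i`. This yields embeddings of `R`
into projective modules `Yᵢ` with `id Yᵢ ≤ i` whose cokernels have larger and larger parts of an
injective coresolution with `pd Eʲ ≤ j`. The ring is right Noetherian, so all of them factor through
a single map `R → Rᵗ` whose coordinates factor through finitely many of the `Yᵢ`. Its cokernel lies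
in `𝒢_∞(0)`, hence is projective, so `R` is a direct summand of `Rᵗ` through a map that factors
through finitely many `Yᵢ`, and `id R < ∞`.

Therefore every finitely generated projective module has a finite injective coresolution by modules
of finite projective dimension, and so its class in `K₀` is a combination of the classes of those
envelopes of simple modules that have finite projective dimension. Since the rank of `K₀` is the
number of simple modules, all these envelopes have finite projective dimension. Hence every finitely
generated module lies in `𝒢_∞(D)` for a common `D`, and then has projective dimension at most `D`.
-/

namespace AuslanderType

/-! ### Short exact sequences -/

section ShortExact

variable {R : Type*} [Ring R]

/-- Short exact sequences `0 → A → B → C → 0` of unbundled modules. -/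
structure IsSES {A B C : Type*} [AddCommGroup A] [Module R A] [AddCommGroup B] [Module R B]
    [AddCommGroup C] [Module R C] (f : A →ₗ[R] B) (g : B →ₗ[R] C) : Prop where
  injective : Function.Injective f
  surjective : Function.Surjective g
  exact : Function.Exact f g

variable {A B C E K M N P Q : Type*} [AddCommGroup A] [Module R A] [AddCommGroup B] [Module R B]
  [AddCommGroup C] [Module R C] [AddCommGroup E] [Module R E] [AddCommGroup K] [Module R K]
  [AddCommGroup M] [Module R M] [AddCommGroup N] [Module R N] [AddCommGroup P] [Module R P]
  [AddCommGroup Q] [Module R Q]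

theorem isSES_mkQ (K : Submodule R M) : IsSES K.subtype K.mkQ :=
  ⟨K.injective_subtype, K.mkQ_surjective, LinearMap.exact_subtype_mkQ K⟩

theorem isSES_ker {g : M →ₗ[R] N} (hg : Function.Surjective g) :
    IsSES (LinearMap.ker g).subtype g :=
  ⟨Submodule.injective_subtype _, hg, LinearMap.exact_subtype_ker_map g⟩

theorem isSES_range {f : M →ₗ[R] N} (hf : Function.Injective f) :
    IsSES f (LinearMap.range f).mkQ :=
  ⟨hf, Submodule.mkQ_surjective _, LinearMap.exact_map_mkQ_range f⟩

theorem isSES_inl_snd : IsSES (LinearMap.inl R M N) (LinearMap.snd R M N) :=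
  ⟨LinearMap.inl_injective, LinearMap.snd_surjective, .inl_snd⟩

theorem isSES_inr_fst : IsSES (LinearMap.inr R M N) (LinearMap.fst R M N) :=
  ⟨LinearMap.inr_injective, LinearMap.fst_surjective, .inr_fst⟩

theorem isSES_id_zero [Subsingleton N] : IsSES (LinearMap.id : M →ₗ[R] M) (0 : M →ₗ[R] N) :=
  ⟨Function.injective_id, Function.surjective_to_subsingleton _, fun x ↦ by simp⟩

theorem isSES_zero_id [Subsingleton N] : IsSES (0 : N →ₗ[R] M) (LinearMap.id : M →ₗ[R] M) :=
  ⟨Function.injective_of_subsingleton _, Function.surjective_id, fun x ↦ by simp [eq_comm]⟩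

namespace IsSES

variable {f : A →ₗ[R] B} {g : B →ₗ[R] C}

theorem apply_apply_eq_zero (h : IsSES f g) (a : A) : g (f a) = 0 :=
  h.exact.apply_apply_eq_zero a

theorem comp_equiv (h : IsSES f g) (e : M ≃ₗ[R] A) : IsSES (f ∘ₗ e.toLinearMap) g :=
  ⟨h.injective.comp e.injective, h.surjective, fun b ↦ by
    rw [h.exact b, LinearMap.coe_comp, LinearEquiv.coe_coe, e.surjective.range_comp]⟩

theorem equiv_comp (h : IsSES f g) (e : C ≃ₗ[R] M) : IsSES f (e.toLinearMap ∘ₗ g) :=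
  ⟨h.injective, e.surjective.comp h.surjective, fun b ↦ by simp [← h.exact b]⟩

theorem finsupp (ι : Type*) (h : IsSES f g) :
    IsSES (Finsupp.mapRange.linearMap (α := ι) f) (Finsupp.mapRange.linearMap (α := ι) g) := by
  refine ⟨Finsupp.mapRange_injective f (map_zero f) h.injective,
    Finsupp.mapRange_surjective g (map_zero g) h.surjective, fun b ↦ ⟨fun hb ↦ ?_, ?_⟩⟩
  · choose a ha using fun i ↦ (h.exact (b i)).1 (by simpa using DFunLike.congr_fun hb i)
    refine ⟨Finsupp.onFinset b.support a fun i hi ↦ ?_, Finsupp.ext fun i ↦ by simp [ha]⟩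
    exact Finsupp.mem_support_iff.2 fun h0 ↦ hi (h.injective (by rw [ha, h0, map_zero]))
  · rintro ⟨a, rfl⟩
    ext i
    simp [h.apply_apply_eq_zero]

theorem pi {ι : Type*} {A B C : ι → Type*} [∀ i, AddCommGroup (A i)] [∀ i, Module R (A i)]
    [∀ i, AddCommGroup (B i)] [∀ i, Module R (B i)] [∀ i, AddCommGroup (C i)]
    [∀ i, Module R (C i)] {f : ∀ i, A i →ₗ[R] B i} {g : ∀ i, B i →ₗ[R] C i}
    (h : ∀ i, IsSES (f i) (g i)) : IsSES (LinearMap.piMap f) (LinearMap.piMap g) := by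
  refine ⟨.piMap fun i ↦ (h i).injective, .piMap fun i ↦ (h i).surjective,
    fun x ↦ ⟨fun hx ↦ ?_, ?_⟩⟩
  · choose y hy using fun i ↦ ((h i).exact (x i)).1 (congrFun hx i)
    exact ⟨y, funext hy⟩
  · rintro ⟨y, rfl⟩
    exact funext fun i ↦ (h i).apply_apply_eq_zero (y i)

theorem prodMap_id (h : IsSES f g) :
    IsSES (LinearMap.inl R B M ∘ₗ f) (g.prodMap (LinearMap.id : M →ₗ[R] M)) := by
  refine ⟨LinearMap.inl_injective.comp h.injective,
    h.surjective.prodMap Function.surjective_id, fun x ↦ ?_⟩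
  simp [Prod.ext_iff, h.exact x.1, and_comm, eq_comm (a := (0 : M))]

theorem id_prodMap (h : IsSES f g) :
    IsSES ((LinearMap.id : M →ₗ[R] M).prodMap f) (g ∘ₗ LinearMap.snd R M B) := by
  refine ⟨Function.injective_id.prodMap h.injective,
    h.surjective.comp LinearMap.snd_surjective, fun x ↦ ?_⟩
  simp [Prod.ext_iff, h.exact x.2]

theorem exists_desc (h : IsSES f g) (φ : B →ₗ[R] M) (hφ : φ ∘ₗ f = 0) :
    ∃ ψ : C →ₗ[R] M, ψ ∘ₗ g = φ := by
  have hle : LinearMap.ker g ≤ LinearMap.ker φ := by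
    rw [h.exact.linearMap_ker_eq]
    exact LinearMap.range_le_ker_iff.2 hφ
  refine ⟨(LinearMap.ker g).liftQ φ hle ∘ₗ
    (g.quotKerEquivOfSurjective h.surjective).symm.toLinearMap, LinearMap.ext fun b ↦ ?_⟩
  have : (g.quotKerEquivOfSurjective h.surjective).symm (g b) = Submodule.Quotient.mk b := by
    rw [LinearEquiv.symm_apply_eq]
    rfl
  simp [this]

theorem exists_lift (h : IsSES f g) (φ : M →ₗ[R] B) (hφ : g ∘ₗ φ = 0) :
    ∃ ψ : M →ₗ[R] A, f ∘ₗ ψ = φ := by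
  have hmem (m : M) : φ m ∈ LinearMap.range f := (h.exact _).1 (LinearMap.congr_fun hφ m)
  refine ⟨(LinearEquiv.ofInjective f h.injective).symm.toLinearMap ∘ₗ φ.codRestrict _ hmem,
    LinearMap.ext fun m ↦ ?_⟩
  exact congrArg Subtype.val
    ((LinearEquiv.ofInjective f h.injective).apply_symm_apply ⟨φ m, hmem m⟩)

theorem exists_isSES_coker_comp (h : IsSES f g) {i : B →ₗ[R] E} {p : E →ₗ[R] N}
    (h' : IsSES i p) {r : E →ₗ[R] Q} (hr : IsSES (i ∘ₗ f) r) :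
    ∃ (φ : C →ₗ[R] Q) (ψ : Q →ₗ[R] N), IsSES φ ψ := by
  obtain ⟨φ, hφ⟩ := h.exists_desc (r ∘ₗ i) (LinearMap.ext hr.apply_apply_eq_zero)
  obtain ⟨ψ, hψ⟩ := hr.exists_desc p (LinearMap.ext fun a ↦ h'.apply_apply_eq_zero (f a))
  replace hφ (b : B) : φ (g b) = r (i b) := LinearMap.congr_fun hφ b
  replace hψ (x : E) : ψ (r x) = p x := LinearMap.congr_fun hψ x
  refine ⟨φ, ψ, (injective_iff_map_eq_zero φ).2 fun c hc ↦ ?_, fun n ↦ ?_,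
    fun x ↦ ⟨fun hx ↦ ?_, ?_⟩⟩
  · obtain ⟨b, rfl⟩ := h.surjective c
    obtain ⟨a, ha⟩ := (hr.exact (i b)).1 ((hφ b).symm.trans hc)
    rw [← h'.injective ha, h.apply_apply_eq_zero]
  · obtain ⟨x, rfl⟩ := h'.surjective n
    exact ⟨r x, hψ x⟩
  · obtain ⟨x, rfl⟩ := hr.surjective x
    obtain ⟨b, rfl⟩ := (h'.exact x).1 ((hψ x).symm.trans hx)
    exact ⟨g b, hφ b⟩
  · rintro ⟨c, rfl⟩
    obtain ⟨b, rfl⟩ := h.surjective c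
    rw [hφ, hψ, h'.apply_apply_eq_zero]

theorem exists_isSES_ker_comp {i : K →ₗ[R] P} {p : P →ₗ[R] B} (h : IsSES i p) (h' : IsSES f g)
    {j : Q →ₗ[R] P} (hj : IsSES j (g ∘ₗ p)) :
    ∃ (φ : K →ₗ[R] Q) (ψ : Q →ₗ[R] A), IsSES φ ψ := by
  obtain ⟨φ, hφ⟩ := hj.exists_lift i (by ext k; simp [h.apply_apply_eq_zero])
  obtain ⟨ψ, hψ⟩ := h'.exists_lift (p ∘ₗ j) (LinearMap.ext hj.apply_apply_eq_zero)
  replace hφ (k : K) : j (φ k) = i k := LinearMap.congr_fun hφ k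
  replace hψ (x : Q) : f (ψ x) = p (j x) := LinearMap.congr_fun hψ x
  refine ⟨φ, ψ, fun k k' hk ↦ h.injective ?_, fun a ↦ ?_, fun x ↦ ⟨fun hx ↦ ?_, ?_⟩⟩
  · rw [← hφ, hk, hφ]
  · obtain ⟨y, hy⟩ := h.surjective (f a)
    obtain ⟨x, rfl⟩ := (hj.exact y).1 (by simp [hy, h'.apply_apply_eq_zero])
    exact ⟨x, h'.injective ((hψ x).trans hy)⟩
  · obtain ⟨k, hk⟩ := (h.exact (j x)).1 (by rw [← hψ, hx, map_zero])
    exact ⟨k, hj.injective ((hφ k).trans hk)⟩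
  · rintro ⟨k, rfl⟩
    exact h'.injective (by rw [hψ, hφ, h.apply_apply_eq_zero, map_zero])

theorem exists_isSES_pushout (h : IsSES f g) {i : A →ₗ[R] E} {p : E →ₗ[R] N} (h' : IsSES i p)
    {F : B →ₗ[R] E} (hF : F ∘ₗ f = i) : ∃ ψ : E × C →ₗ[R] N, IsSES (F.prod g) ψ := by
  subst hF
  obtain ⟨δ, hδ⟩ := h.exists_desc (p ∘ₗ F) (LinearMap.ext h'.apply_apply_eq_zero)
  replace hδ (b : B) : δ (g b) = p (F b) := LinearMap.congr_fun hδ b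
  refine ⟨p.coprod (-δ), (injective_iff_map_eq_zero _).2 fun b hb ↦ ?_, fun n ↦ ?_,
    fun x ↦ ⟨fun hx ↦ ?_, ?_⟩⟩
  · obtain ⟨hb₁, hb₂⟩ : F b = 0 ∧ g b = 0 := by simpa using hb
    obtain ⟨a, rfl⟩ := (h.exact b).1 hb₂
    rw [h'.injective (hb₁.trans (map_zero _).symm), map_zero]
  · obtain ⟨x, rfl⟩ := h'.surjective n
    exact ⟨(x, 0), by simp⟩
  · obtain ⟨x, c⟩ := x
    obtain ⟨b, rfl⟩ := h.surjective c
    obtain ⟨a, ha⟩ := (h'.exact (x - F b)).1 (by simpa [hδ, sub_eq_add_neg] using hx)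
    refine ⟨b + f a, Prod.ext ?_ ?_⟩
    · simpa [add_comm] using eq_sub_iff_add_eq.1 ha
    · simp [h.apply_apply_eq_zero]
  · rintro ⟨b, rfl⟩
    simp [hδ]

theorem exists_isSES_pullback (h : IsSES f g) {i : K →ₗ[R] P} {p : P →ₗ[R] C} (h' : IsSES i p)
    {σ : P →ₗ[R] B} (hσ : g ∘ₗ σ = p) : ∃ φ : K →ₗ[R] A × P, IsSES φ (f.coprod σ) := by
  subst hσ
  obtain ⟨δ, hδ⟩ := h.exists_lift (σ ∘ₗ i) (LinearMap.ext h'.apply_apply_eq_zero)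
  replace hδ (k : K) : f (δ k) = σ (i k) := LinearMap.congr_fun hδ k
  refine ⟨(-δ).prod i, fun k k' hk ↦ h'.injective (congrArg Prod.snd hk), fun b ↦ ?_,
    fun x ↦ ⟨fun hx ↦ ?_, ?_⟩⟩
  · obtain ⟨y, hy⟩ := h'.surjective (g b)
    obtain ⟨a, ha⟩ := (h.exact (b - σ y)).1 (by simpa [sub_eq_zero] using hy.symm)
    exact ⟨(a, y), by simp [ha]⟩
  · obtain ⟨a, y⟩ := x
    have hx : f a + σ y = 0 := by simpa using hx
    obtain ⟨k, rfl⟩ := (h'.exact y).1 (by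
      simpa [h.apply_apply_eq_zero] using congrArg g hx)
    refine ⟨k, Prod.ext (h.injective ?_) rfl⟩
    simpa [hδ] using (eq_neg_of_add_eq_zero_left hx).symm
  · rintro ⟨k, rfl⟩
    simp [hδ]

theorem exists_isSES_horseshoe_projective (h : IsSES f g) {K' P' : Type*} [AddCommGroup K']
    [Module R K'] [AddCommGroup P'] [Module R P'] [Module.Projective R P'] {i : K →ₗ[R] P}
    {p : P →ₗ[R] A} {i' : K' →ₗ[R] P'} {p' : P' →ₗ[R] C} (hA : IsSES i p) (hC : IsSES i' p') :
    ∃ (π : P × P' →ₗ[R] B) (φ : K →ₗ[R] LinearMap.ker π) (ψ : LinearMap.ker π →ₗ[R] K'),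
      Function.Surjective π ∧ IsSES φ ψ := by
  obtain ⟨σ, hσ⟩ := Module.projective_lifting_property g p' h.surjective
  obtain ⟨φ', hφ'⟩ := h.exists_isSES_pullback hC hσ
  have hp := hA.prodMap_id (M := P')
  have hπ := hφ'.surjective.comp hp.surjective
  obtain ⟨φ, ψ, hφψ⟩ := hp.exists_isSES_ker_comp hφ' (isSES_ker hπ)
  exact ⟨_, φ, ψ, hπ, hφψ⟩

theorem exists_retraction_of_projective (h : IsSES f g) [Module.Projective R C] :
    ∃ r : B →ₗ[R] A, r ∘ₗ f = LinearMap.id :=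
  ((h.exact.split_tfae h.injective h.surjective).out 0 1).1
    (Module.projective_lifting_property g LinearMap.id h.surjective)

theorem nonempty_equiv_prod_of_retraction (h : IsSES f g) {r : B →ₗ[R] A}
    (hr : r ∘ₗ f = LinearMap.id) : Nonempty (B ≃ₗ[R] A × C) :=
  ⟨(h.exact.splitInjectiveEquiv h.surjective ⟨r, hr⟩).1⟩

theorem nonempty_equiv_prod_of_projective (h : IsSES f g) [Module.Projective R C] :
    Nonempty (B ≃ₗ[R] A × C) :=
  h.exists_retraction_of_projective.elim fun _ ↦ h.nonempty_equiv_prod_of_retraction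

end IsSES

end ShortExact

/-! ### Homological dimensions -/

section Dimension

variable {R : Type u} [Ring R]

variable (R) in
/-- The unbundled module `M` has projective dimension at most `n`. -/
def PdLE (n : ℕ) (M : Type u) [AddCommGroup M] [Module R M] : Prop :=
  HasProjectiveDimensionLE (ModuleCat.of R M) n

variable (R) in
/-- The unbundled module `M` has injective dimension at most `n`. -/
def IdLE (n : ℕ) (M : Type u) [AddCommGroup M] [Module R M] : Prop :=
  HasInjectiveDimensionLE (ModuleCat.of R M) n

variable {A B C M N : Type u} [AddCommGroup A] [Module R A] [AddCommGroup B] [Module R B]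
  [AddCommGroup C] [Module R C] [AddCommGroup M] [Module R M] [AddCommGroup N] [Module R N]

namespace IsSES

variable {f : A →ₗ[R] B} {g : B →ₗ[R] C}

theorem shortExact (h : IsSES f g) :
    (ShortComplex.moduleCatMk f g (LinearMap.ext h.apply_apply_eq_zero)).ShortExact where
  exact := (ShortComplex.ShortExact.moduleCat_exact_iff_function_exact _).2 h.exact
  mono_f := (ModuleCat.mono_iff_injective _).2 h.injective
  epi_g := (ModuleCat.epi_iff_surjective _).2 h.surjective

theorem pdLE_left (h : IsSES f g) {n : ℕ} (hB : PdLE R n B) (hC : PdLE R (n + 1) C) :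
    PdLE R n A :=
  h.shortExact.hasProjectiveDimensionLT_X₁ (n + 1) hB hC

theorem pdLE_middle (h : IsSES f g) {n : ℕ} (hA : PdLE R n A) (hC : PdLE R n C) :
    PdLE R n B :=
  h.shortExact.hasProjectiveDimensionLT_X₂ (n + 1) hA hC

theorem pdLE_right (h : IsSES f g) {n : ℕ} (hA : PdLE R n A) (hB : PdLE R (n + 1) B) :
    PdLE R (n + 1) C :=
  h.shortExact.hasProjectiveDimensionLT_X₃ (n + 1) hA hB

theorem idLE_left (h : IsSES f g) {n : ℕ} (hB : IdLE R (n + 1) B) (hC : IdLE R n C) :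
    IdLE R (n + 1) A :=
  h.shortExact.hasInjectiveDimensionLT_X₁ (n + 1) hC hB

theorem idLE_middle (h : IsSES f g) {n : ℕ} (hA : IdLE R n A) (hC : IdLE R n C) :
    IdLE R n B :=
  h.shortExact.hasInjectiveDimensionLT_X₂ (n + 1) hA hC

theorem idLE_right (h : IsSES f g) {n : ℕ} (hA : IdLE R (n + 1) A) (hB : IdLE R n B) :
    IdLE R n C :=
  h.shortExact.hasInjectiveDimensionLT_X₃ (n + 1) hB hA

theorem exists_extension_of_subsingleton_ext (h : IsSES f g)
    [Subsingleton (Abelian.Ext (ModuleCat.of R C) (ModuleCat.of R M) 1)] (φ : A →ₗ[R] M) :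
    ∃ ψ : B →ₗ[R] M, ψ ∘ₗ f = φ := by
  obtain ⟨x, hx⟩ := Abelian.Ext.contravariant_sequence_exact₁ h.shortExact (ModuleCat.of R M)
    (Abelian.Ext.mk₀ (ModuleCat.ofHom φ)) (add_zero 1)
    (Subsingleton.elim (α := Abelian.Ext (ModuleCat.of R C) (ModuleCat.of R M) 1) _ _)
  obtain ⟨ψ, rfl⟩ := Abelian.Ext.homEquiv₀.symm.surjective x
  have : ModuleCat.ofHom f ≫ ψ = ModuleCat.ofHom φ :=
    Abelian.Ext.homEquiv₀.symm.injective ((Abelian.Ext.mk₀_comp_mk₀ _ _).symm.trans hx)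
  exact ⟨ψ.hom, congrArg ModuleCat.Hom.hom this⟩

theorem subsingleton_ext_of_projective (h : IsSES f g) [Module.Projective R B] (n : ℕ)
    [Subsingleton (Abelian.Ext (ModuleCat.of R C) (ModuleCat.of R M) (n + 2))] :
    Subsingleton (Abelian.Ext (ModuleCat.of R A) (ModuleCat.of R M) (n + 1)) := by
  have : Projective (ModuleCat.of R B) := (IsProjective.iff_projective B).1 inferInstance
  refine subsingleton_of_forall_eq 0 fun x ↦ ?_
  obtain ⟨y, rfl⟩ := Abelian.Ext.contravariant_sequence_exact₁ h.shortExact (ModuleCat.of R M)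
    x (by omega : 1 + (n + 1) = n + 2)
    (Subsingleton.elim (α := Abelian.Ext (ModuleCat.of R C) (ModuleCat.of R M) (n + 2)) _ _)
  rw [Abelian.Ext.eq_zero_of_projective (P := ModuleCat.of R B) y]
  exact Abelian.Ext.comp_zero ..

end IsSES

theorem pdLE_zero_iff : PdLE R 0 M ↔ Module.Projective R M :=
  projective_iff_hasProjectiveDimensionLT_one.symm.trans (IsProjective.iff_projective M).symm

theorem idLE_zero_iff : IdLE R 0 M ↔ Module.Injective R M :=
  injective_iff_hasInjectiveDimensionLT_one.symm.trans
    (Module.injective_iff_injective_object R M).symm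

theorem PdLE.mono {m n : ℕ} (h : PdLE R m M) (hmn : m ≤ n) : PdLE R n M :=
  have : HasProjectiveDimensionLT (ModuleCat.of R M) (m + 1) := h
  hasProjectiveDimensionLT_of_ge _ (m + 1) (n + 1) (by omega)

theorem IdLE.mono {m n : ℕ} (h : IdLE R m M) (hmn : m ≤ n) : IdLE R n M :=
  have : HasInjectiveDimensionLT (ModuleCat.of R M) (m + 1) := h
  hasInjectiveDimensionLT_of_ge _ (m + 1) (n + 1) (by omega)

theorem pdLE_of_projective [h : Module.Projective R M] (n : ℕ) : PdLE R n M :=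
  (pdLE_zero_iff.2 h).mono (Nat.zero_le n)

theorem idLE_of_injective [h : Module.Injective R M] (n : ℕ) : IdLE R n M :=
  (idLE_zero_iff.2 h).mono (Nat.zero_le n)

/-- A linear map with a left inverse, as a retract in the category of modules. -/
def retractOfLeftInverse {i : M →ₗ[R] N} {r : N →ₗ[R] M} (h : r ∘ₗ i = LinearMap.id) :
    Retract (ModuleCat.of R M) (ModuleCat.of R N) where
  i := ModuleCat.ofHom i
  r := ModuleCat.ofHom r
  retract := by rw [← ModuleCat.ofHom_comp, h, ModuleCat.ofHom_id]

theorem PdLE.retract {n : ℕ} (hN : PdLE R n N) {i : M →ₗ[R] N} {r : N →ₗ[R] M}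
    (h : r ∘ₗ i = LinearMap.id) : PdLE R n M :=
  have : HasProjectiveDimensionLT (ModuleCat.of R N) (n + 1) := hN
  (retractOfLeftInverse h).hasProjectiveDimensionLT (n + 1)

theorem IdLE.retract {n : ℕ} (hN : IdLE R n N) {i : M →ₗ[R] N} {r : N →ₗ[R] M}
    (h : r ∘ₗ i = LinearMap.id) : IdLE R n M :=
  have : HasInjectiveDimensionLT (ModuleCat.of R N) (n + 1) := hN
  (retractOfLeftInverse h).hasInjectiveDimensionLT (n + 1)

theorem PdLE.congr {n : ℕ} (hM : PdLE R n M) (e : M ≃ₗ[R] N) : PdLE R n N :=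
  hM.retract e.comp_symm

theorem IdLE.congr {n : ℕ} (hM : IdLE R n M) (e : M ≃ₗ[R] N) : IdLE R n N :=
  hM.retract e.comp_symm

theorem pdLE_prod_iff {n : ℕ} : PdLE R n (M × N) ↔ PdLE R n M ∧ PdLE R n N :=
  ⟨fun h ↦ ⟨h.retract (LinearMap.fst_comp_inl ..), h.retract (LinearMap.snd_comp_inr ..)⟩,
    fun h ↦ isSES_inl_snd.pdLE_middle h.1 h.2⟩

theorem idLE_prod_iff {n : ℕ} : IdLE R n (M × N) ↔ IdLE R n M ∧ IdLE R n N :=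
  ⟨fun h ↦ ⟨h.retract (LinearMap.fst_comp_inl ..), h.retract (LinearMap.snd_comp_inr ..)⟩,
    fun h ↦ isSES_inl_snd.idLE_middle h.1 h.2⟩

theorem injective_prod_iff :
    Module.Injective R (M × N) ↔ Module.Injective R M ∧ Module.Injective R N := by
  simp only [← idLE_zero_iff, idLE_prod_iff]

instance [Module.Injective R M] [Module.Injective R N] : Module.Injective R (M × N) :=
  injective_prod_iff.2 ⟨inferInstance, inferInstance⟩

theorem IsSES.nonempty_equiv_prod_of_injective {f : A →ₗ[R] B} {g : B →ₗ[R] C} (h : IsSES f g)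
    [Module.Injective R A] : Nonempty (B ≃ₗ[R] A × C) := by
  obtain ⟨r, hr⟩ := Module.Injective.extension_property R A A B f h.injective LinearMap.id
  exact h.nonempty_equiv_prod_of_retraction hr

theorem IsSES.exists_isSES_horseshoe_injective {f : A →ₗ[R] B} {g : B →ₗ[R] C} (h : IsSES f g)
    {E E' N N' : Type u} [AddCommGroup E] [Module R E] [Module.Injective R E] [AddCommGroup E']
    [Module R E'] [AddCommGroup N] [Module R N] [AddCommGroup N'] [Module R N']
    {i : A →ₗ[R] E} {p : E →ₗ[R] N} {i' : C →ₗ[R] E'} {p' : E' →ₗ[R] N'}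
    (hA : IsSES i p) (hC : IsSES i' p') :
    ∃ (j : B →ₗ[R] E × E') (φ : N →ₗ[R] (E × E') ⧸ LinearMap.range j)
      (ψ : ((E × E') ⧸ LinearMap.range j) →ₗ[R] N'), Function.Injective j ∧ IsSES φ ψ := by
  obtain ⟨F, hF⟩ := Module.Injective.extension_property R E A B f h.injective i
  obtain ⟨δ, hδ⟩ := h.exists_isSES_pushout hA hF
  have hi' := hC.id_prodMap (M := E)
  have hj := hi'.injective.comp hδ.injective
  obtain ⟨φ, ψ, hφψ⟩ := hδ.exists_isSES_coker_comp hi' (isSES_range hj)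
  exact ⟨_, φ, ψ, hj, hφψ⟩

theorem PdLE.finsupp (ι : Type u) {n : ℕ} (hM : PdLE R n M) : PdLE R n (ι →₀ M) := by
  induction n generalizing M with
  | zero =>
    have := pdLE_zero_iff.1 hM
    classical
    have : Module.Projective R (ι →₀ M) :=
      .of_equiv' (finsuppLEquivDirectSum R M ι).symm
    exact pdLE_of_projective 0
  | succ n ih =>
    have hs := isSES_ker (Finsupp.linearCombination_id_surjective R M)
    have hK := ih (hs.pdLE_left (pdLE_of_projective n) hM)
    exact (hs.finsupp ι).pdLE_right hK (pdLE_of_projective _)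

variable (R M) in
theorem exists_isSES_injective :
    ∃ (E N : Type u) (_ : AddCommGroup E) (_ : Module R E) (_ : AddCommGroup N) (_ : Module R N)
      (f : M →ₗ[R] E) (g : E →ₗ[R] N), Module.Injective R E ∧ IsSES f g := by
  let E : ModuleCat.{u} R := Injective.under (ModuleCat.of R M)
  let j : M →ₗ[R] E := (Injective.ι (ModuleCat.of R M)).hom
  have hj : Function.Injective j := (ModuleCat.mono_iff_injective _).1 inferInstance
  have hE : Module.Injective R E :=
    (Module.injective_iff_injective_object R E).2 (inferInstanceAs (Injective E))
  exact ⟨_, _, _, _, _, _, j, _, hE, isSES_range hj⟩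

theorem IdLE.pi {ι : Type u} {X : ι → Type u} [∀ i, AddCommGroup (X i)] [∀ i, Module R (X i)]
    {n : ℕ} (hX : ∀ i, IdLE R n (X i)) : IdLE R n (∀ i, X i) := by
  induction n generalizing X with
  | zero =>
    have (i : ι) : Module.Injective R (X i) := idLE_zero_iff.1 (hX i)
    exact idLE_of_injective 0
  | succ n ih =>
    choose E N _ _ _ _ f g _ hfg using fun i ↦ exists_isSES_injective R (X i)
    have hN (i : ι) : IdLE R n (N i) := (hfg i).idLE_right (hX i) (idLE_of_injective n)
    exact (IsSES.pi hfg).idLE_left (idLE_of_injective _) (ih hN)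

end Dimension

/-! ### Flat modules over a semiprimary ring are projective -/

namespace BalancedTensor

section

variable {R : Type u} [Ring R] {N N' M : Type u} [AddCommGroup N] [Module Rᵐᵒᵖ N]
  [AddCommGroup N'] [Module Rᵐᵒᵖ N'] [AddCommGroup M] [Module R M]

variable (R) in
/-- The class `mk R n m` of the pure tensor `n ⊗ m` in `N ⊗_R M`, as a biadditive map. -/
def mk : N →+ M →+ BalancedTensor R N M :=
  AddMonoidHom.mk' (fun n ↦ (QuotientAddGroup.mk' _).comp (TensorProduct.mk ℤ N M n).toAddMonoidHom)
    fun n n' ↦ by ext m; simp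

theorem mk_smul (r : R) (n : N) (m : M) : mk R (MulOpposite.op r • n) m = mk R n (r • m) := by
  rw [← sub_eq_zero]
  exact (QuotientAddGroup.eq_zero_iff _).2 (AddSubgroup.subset_closure ⟨n, r, m, rfl⟩)

theorem map_mk (f : N →ₗ[Rᵐᵒᵖ] N') (n : N) (m : M) :
    BalancedTensor.map M f (mk R n m) = mk R (f n) m := rfl

theorem hom_ext {Q : Type*} [AddCommGroup Q] {φ ψ : BalancedTensor R N M →+ Q}
    (h : ∀ n m, φ (mk R n m) = ψ (mk R n m)) : φ = ψ := by
  refine QuotientAddGroup.addMonoidHom_ext _ (AddMonoidHom.ext fun t ↦ ?_)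
  induction t with
  | zero => simp
  | tmul n m => exact h n m
  | add x y hx hy => rw [map_add, map_add, hx, hy]

/-- The additive map out of `N ⊗_R M` given by an `R`-balanced biadditive map. -/
def lift {Q : Type*} [AddCommGroup Q] (f : N →+ M →+ Q)
    (hf : ∀ (r : R) n m, f (MulOpposite.op r • n) m = f n (r • m)) :
    BalancedTensor R N M →+ Q :=
  QuotientAddGroup.lift _ (TensorProduct.liftAddHom f fun z n m ↦ by simp) <| by
    refine (AddSubgroup.closure_le _).2 ?_
    rintro _ ⟨n, r, m, rfl⟩
    simp [hf]

variable (N) in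
/-- The map `N ⊗_R M → N ⊗_R R^(M) = N^(M)` induced by `s : M → R^(M)`. -/
noncomputable def coords (s : M →ₗ[R] M →₀ R) : BalancedTensor R N M →+ (M →₀ N) :=
  lift
    (AddMonoidHom.mk' (fun n ↦ (Finsupp.mapRange.addMonoidHom
        (AddMonoidHom.mk' (fun r : R ↦ MulOpposite.op r • n) fun r r' ↦ by simp [add_smul])).comp
          s.toAddMonoidHom)
      fun n n' ↦ by ext; simp)
    fun r n m ↦ by ext; simp [mul_smul]

theorem coords_map (s : M →ₗ[R] M →₀ R) (f : N →ₗ[Rᵐᵒᵖ] N') (x : BalancedTensor R N M) :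
    coords N' s (BalancedTensor.map M f x) = Finsupp.mapRange f (map_zero f) (coords N s x) := by
  suffices (coords N' s).comp (BalancedTensor.map M f) =
      (Finsupp.mapRange.addMonoidHom f.toAddMonoidHom).comp (coords N s) from
    DFunLike.congr_fun this x
  refine hom_ext fun n m ↦ Finsupp.ext fun i ↦ ?_
  exact (map_smul f (MulOpposite.op (s m i)) n).symm

theorem coords_injective {s : M →ₗ[R] M →₀ R}
    (hs : Function.LeftInverse (Finsupp.linearCombination R id) s) :
    Function.Injective (coords N s) := by
  let ψ : (M →₀ N) →+ BalancedTensor R N M := Finsupp.liftAddHom fun m ↦ (mk R).flip m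
  suffices ψ.comp (coords N s) = AddMonoidHom.id _ from
    Function.LeftInverse.injective (g := ψ) fun x ↦ DFunLike.congr_fun this x
  refine hom_ext fun n m ↦ ?_
  calc ψ (coords N s (mk R n m))
      = (s m).sum fun i r ↦ mk R (MulOpposite.op r • n) i :=
        Finsupp.sum_mapRange_index (hf := map_zero _) (by simp)
    _ = (s m).sum fun i r ↦ mk R n (r • i) := by simp only [mk_smul]
    _ = mk R n ((s m).sum fun i r ↦ r • i) := by rw [map_finsuppSum]
    _ = mk R n m := congrArg (mk R n) (hs m)

end

end BalancedTensor

section FlatProjective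

open BalancedTensor

variable {R : Type u} [Ring R] {M F : Type u} [AddCommGroup M] [Module R M] [AddCommGroup F]
  [Module R F]

theorem isFlat_of_projective [hM : Module.Projective R M] : IsFlat R M := by
  obtain ⟨s, hs⟩ := hM.out
  intro N N' _ _ _ _ f hf x y hxy
  refine coords_injective hs (Finsupp.mapRange_injective f (map_zero f) hf ?_)
  rw [← coords_map, ← coords_map, hxy]

/-- A two-sided ideal as a right submodule of the ring. -/
def rightSubmodule (J : Ideal R) [J.IsTwoSided] : Submodule Rᵐᵒᵖ R where
  carrier := J
  add_mem' := J.add_mem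
  zero_mem' := J.zero_mem
  smul_mem' r _ hx := J.mul_mem_right r.unop hx

theorem exists_balancedTensor_rightSubmodule_hom (J : Ideal R) [J.IsTwoSided] {p : F →ₗ[R] M}
    (hp : Function.Surjective p) :
    ∃ Φ : BalancedTensor R (rightSubmodule J) M →+ F ⧸ (J • LinearMap.ker p),
      ∀ j y, Φ (mk R j (p y)) = Submodule.Quotient.mk (j.1 • y) := by
  let s := Function.surjInv hp
  have hs : ∀ m, p (s m) = m := Function.surjInv_eq hp
  have mk_smul_eq {j : R} (hj : j ∈ J) {y z : F} (h : p y = p z) :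
      Submodule.Quotient.mk (p := J • LinearMap.ker p) (j • y) = Submodule.Quotient.mk (j • z) := by
    rw [Submodule.Quotient.eq, ← smul_sub]
    exact Submodule.smul_mem_smul hj (by simp [h])
  refine ⟨lift
    (AddMonoidHom.mk' (fun j ↦ AddMonoidHom.mk' (fun m ↦ Submodule.Quotient.mk (j.1 • s m))
        fun m m' ↦ ?_) fun j j' ↦ by ext m; simp [add_smul])
    fun r j m ↦ ?_, fun j y ↦ mk_smul_eq j.2 (hs _)⟩
  · rw [← Submodule.Quotient.mk_add, ← smul_add]
    exact mk_smul_eq j.2 (by simp [hs])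
  · change Submodule.Quotient.mk ((j.1 * r) • s m) = Submodule.Quotient.mk (j.1 • s (r • m))
    rw [mul_smul]
    exact mk_smul_eq j.2 (by simp [hs])

theorem IsFlat.mem_smul_ker (hM : IsFlat R M) (J : Ideal R) [J.IsTwoSided] {p : F →ₗ[R] M}
    (hp : Function.Surjective p) {x : F} (hx : x ∈ J • (⊤ : Submodule R F)) (hpx : p x = 0) :
    x ∈ J • LinearMap.ker p := by
  obtain ⟨Φ, hΦ⟩ := exists_balancedTensor_rightSubmodule_hom J hp
  obtain ⟨t, ht, ht'⟩ : ∃ t : BalancedTensor R (rightSubmodule J) M,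
      Φ t = Submodule.Quotient.mk x ∧
        BalancedTensor.map M (rightSubmodule J).subtype t = mk R (1 : R) (p x) := by
    clear hpx
    induction hx using Submodule.smul_induction_on' with
    | smul j hj y _ =>
      refine ⟨mk R (⟨j, hj⟩ : rightSubmodule J) (p y), hΦ _ _, ?_⟩
      rw [map_mk, map_smul, ← mk_smul]
      simp
    | add x _ y _ hx hy =>
      obtain ⟨t, h₁, h₂⟩ := hx
      obtain ⟨t', h₁', h₂'⟩ := hy
      exact ⟨t + t', by simp [h₁, h₁'], by simp [h₂, h₂']⟩
  rw [hpx, map_zero, ← map_zero (BalancedTensor.map M (rightSubmodule J).subtype)] at ht'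
  rw [hM _ (Submodule.injective_subtype _) ht', map_zero] at ht
  exact (Submodule.Quotient.mk_eq_zero _).1 ht.symm

theorem isSemisimpleModule_of_isTorsionBySet_jacobson [IsSemiprimaryRing R]
    (h : Module.IsTorsionBySet R M (Ring.jacobson R)) : IsSemisimpleModule R M := by
  let _ := h.module
  exact h.isSemisimpleModule_iff.1 inferInstance

instance isSemisimpleModule_quotient_jacobson [IsSemiprimaryRing R] :
    IsSemisimpleModule R (M ⧸ (Ring.jacobson R • ⊤ : Submodule R M)) :=
  isSemisimpleModule_of_isTorsionBySet_jacobson <| (Module.isTorsionBySet_quotient_iff _ _).2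
    fun _ _ hi ↦ Submodule.smul_mem_smul hi trivial

theorem isNilpotent_of_forall_mem_smul {J : Ideal R} (hJ : IsNilpotent J)
    {g : Module.End R M} (hg : ∀ x, g x ∈ J • (⊤ : Submodule R M)) : IsNilpotent g := by
  obtain ⟨n, hn⟩ := hJ
  have map_le (i : ℕ) : (J ^ i • (⊤ : Submodule R M)).map g ≤ J ^ (i + 1) • ⊤ := by
    rw [Submodule.map_smul'', Submodule.pow_succ, Submodule.mul_smul]
    exact Submodule.smul_mono le_rfl (Submodule.map_le_iff_le_comap.2 fun x _ ↦ hg x)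
  have pow_mem (i : ℕ) (x : M) : (g ^ i) x ∈ J ^ i • (⊤ : Submodule R M) := by
    induction i with
    | zero => simp [Submodule.pow_zero, Ideal.one_eq_top]
    | succ i ih =>
      rw [pow_succ', Module.End.mul_apply]
      exact map_le i ⟨_, ih, rfl⟩
  exact ⟨n, LinearMap.ext fun x ↦ by simpa [hn] using pow_mem n x⟩

theorem exists_hom_sub_mem_jacobson_smul [IsSemiprimaryRing R] [Module.Projective R F]
    (K : Submodule R F) :
    ∃ q : F →ₗ[R] K, ∀ x : K, (x - q x : F) ∈ Ring.jacobson R • (⊤ : Submodule R F) := by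
  let π : F →ₗ[R] F ⧸ (Ring.jacobson R • ⊤ : Submodule R F) := Submodule.mkQ _
  obtain ⟨C, hC⟩ := exists_isCompl (K.map π)
  let t : K →ₗ[R] K.map π := π.restrict fun x hx ↦ Submodule.mem_map_of_mem hx
  have ht : Function.Surjective t := by
    rintro ⟨_, x, hx, rfl⟩
    exact ⟨⟨x, hx⟩, rfl⟩
  obtain ⟨q, hq⟩ :=
    Module.projective_lifting_property t (Submodule.projectionOnto _ _ hC ∘ₗ π) ht
  refine ⟨q, fun x ↦ ?_⟩
  have htx : t (q x) = t x :=
    (LinearMap.congr_fun hq (x : F)).trans (Submodule.projectionOnto_apply_left hC (t x))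
  rw [← Submodule.Quotient.eq]
  exact (congrArg Subtype.val htx).symm

theorem exists_retraction_of_forall_mem_smul [IsSemiprimaryRing R] [Module.Projective R F]
    (K : Submodule R F)
    (hK : ∀ x ∈ K, x ∈ Ring.jacobson R • (⊤ : Submodule R F) → x ∈ Ring.jacobson R • K) :
    ∃ r : F →ₗ[R] K, r ∘ₗ K.subtype = LinearMap.id := by
  obtain ⟨q, hq⟩ := exists_hom_sub_mem_jacobson_smul K
  have hqK (x : K) : (x - q x : K) ∈ Ring.jacobson R • (⊤ : Submodule R K) := by
    have hmap : Ring.jacobson R • K = (Ring.jacobson R • (⊤ : Submodule R K)).map K.subtype := by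
      rw [Submodule.map_smul'', Submodule.map_top, Submodule.range_subtype]
    obtain ⟨y, hy, hyx⟩ := hmap ▸ hK _ (K.sub_mem x.2 (q x).2) (hq x)
    rwa [← show y = x - q x from Subtype.ext hyx]
  have hnil : IsNilpotent (1 - q ∘ₗ K.subtype : Module.End R K) :=
    isNilpotent_of_forall_mem_smul IsSemiprimaryRing.isNilpotent hqK
  obtain ⟨w, hw⟩ : IsUnit (q ∘ₗ K.subtype : Module.End R K) := by
    simpa using hnil.isUnit_one_sub
  refine ⟨(↑w⁻¹ : Module.End R K) ∘ₗ q, ?_⟩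
  rw [LinearMap.comp_assoc, ← hw]
  exact w.inv_mul

theorem IsFlat.projective [IsSemiprimaryRing R] (hM : IsFlat R M) : Module.Projective R M := by
  have hp := Finsupp.linearCombination_id_surjective R M
  obtain ⟨r, hr⟩ := exists_retraction_of_forall_mem_smul
    (LinearMap.ker (Finsupp.linearCombination R (id : M → M)))
    fun x hxK hxJ ↦ hM.mem_smul_ker _ hp hxJ hxK
  obtain ⟨e⟩ := (isSES_ker hp).nonempty_equiv_prod_of_retraction hr
  exact pdLE_zero_iff.1 (pdLE_prod_iff.1 ((pdLE_of_projective 0).congr e)).2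

theorem flatDimLE_iff_pdLE [IsSemiprimaryRing R] {n : ℕ} (M : ModuleCat.{u} R) :
    FlatDimLE R n M ↔ PdLE R n M := by
  induction n generalizing M with
  | zero =>
    rw [pdLE_zero_iff]
    exact ⟨fun h ↦ IsFlat.projective h, fun h ↦ isFlat_of_projective⟩
  | succ n ih =>
    constructor
    · rintro ⟨F, p, hF, hp, hK⟩
      have := hF.projective
      exact (isSES_ker hp).pdLE_right ((ih _).1 hK) (pdLE_of_projective _)
    · intro h
      have hp := Finsupp.linearCombination_id_surjective R M
      exact ⟨ModuleCat.of R (M →₀ R), Finsupp.linearCombination R id, isFlat_of_projective, hp,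
        (ih _).2 ((isSES_ker hp).pdLE_left (pdLE_of_projective n) h)⟩

end FlatProjective

/-! ### Injective envelopes -/

section Envelope

variable {R : Type u} [Ring R] {E : Type u} [AddCommGroup E] [Module R E]

/-- `C` is an essential extension of `K` inside the ambient module. -/
def IsEssentialIn (K C : Submodule R E) : Prop :=
  K ≤ C ∧ ∀ L ≤ C, L ⊓ K = ⊥ → L = ⊥

theorem exists_maximal_isEssentialIn (K : Submodule R E) :
    ∃ C : Submodule R E, Maximal (IsEssentialIn K) C := by
  suffices h : ∀ c ⊆ {C | IsEssentialIn K C}, IsChain (· ≤ ·) c → ∀ y ∈ c,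
      ∃ ub ∈ {C | IsEssentialIn K C}, ∀ z ∈ c, z ≤ ub by
    obtain ⟨C, -, hC⟩ := zorn_le_nonempty₀ _ h K
      ⟨le_rfl, fun L hL h ↦ by rwa [inf_eq_left.2 hL] at h⟩
    exact ⟨C, hC⟩
  intro c hc hchain y hy
  refine ⟨sSup c, ⟨(hc hy).1.trans (le_sSup hy), fun L hL h ↦ (Submodule.eq_bot_iff _).2 ?_⟩,
    fun z hz ↦ le_sSup hz⟩
  intro x hx
  obtain ⟨D, hD, hxD⟩ := (Submodule.mem_sSup_of_directed ⟨y, hy⟩ hchain.directedOn).1 (hL hx)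
  refine Submodule.span_singleton_eq_bot.1 ((hc hD).2 (R ∙ x) (by simpa using hxD) ?_)
  exact le_bot_iff.1 (h ▸ inf_le_inf_right K (by simpa using hx))

theorem exists_maximal_disjoint (C : Submodule R E) :
    ∃ D : Submodule R E, Maximal (fun D ↦ D ⊓ C = ⊥) D := by
  suffices h : ∀ c ⊆ {D : Submodule R E | D ⊓ C = ⊥}, IsChain (· ≤ ·) c → ∀ y ∈ c,
      ∃ ub ∈ {D : Submodule R E | D ⊓ C = ⊥}, ∀ z ∈ c, z ≤ ub by
    obtain ⟨D, -, hD⟩ := zorn_le_nonempty₀ _ h ⊥ (bot_inf_eq C)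
    exact ⟨D, hD⟩
  intro c hc hchain y hy
  refine ⟨sSup c, (Submodule.eq_bot_iff _).2 ?_, fun z hz ↦ le_sSup hz⟩
  rintro x ⟨hx, hxC⟩
  obtain ⟨D, hD, hxD⟩ := (Submodule.mem_sSup_of_directed ⟨y, hy⟩ hchain.directedOn).1 hx
  exact (Submodule.eq_bot_iff _).1 (hc hD) x ⟨hxD, hxC⟩

theorem IsEssential.injective {K : Submodule R E} (hK : IsEssential K) {N : Type*}
    [AddCommGroup N] [Module R N] {f : E →ₗ[R] N} (hf : ∀ x ∈ K, f x = 0 → x = 0) :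
    Function.Injective f :=
  LinearMap.ker_eq_bot.1 <| hK _ <| (Submodule.eq_bot_iff _).2 fun x hx ↦ hf x hx.2 hx.1

theorem mkQ_comp_subtype_injective {C D : Submodule R E} (h : D ⊓ C = ⊥) :
    Function.Injective (D.mkQ ∘ₗ C.subtype) := by
  refine (injective_iff_map_eq_zero _).2 fun c hc ↦ Subtype.ext ?_
  exact (Submodule.eq_bot_iff _).1 h c ⟨(Submodule.Quotient.mk_eq_zero D).1 hc, c.2⟩

theorem isEssential_range_mkQ_comp_subtype {C D : Submodule R E}
    (hD : Maximal (fun D ↦ D ⊓ C = ⊥) D) :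
    IsEssential (LinearMap.range (D.mkQ ∘ₗ C.subtype)) := by
  intro L hL
  have hLC : L.comap D.mkQ ⊓ C = ⊥ := by
    refine (Submodule.eq_bot_iff _).2 fun x ⟨hx, hxC⟩ ↦ ?_
    have h0 := (Submodule.eq_bot_iff _).1 hL (D.mkQ x) ⟨hx, ⟨x, hxC⟩, rfl⟩
    exact congrArg Subtype.val (mkQ_comp_subtype_injective hD.prop (a₁ := ⟨x, hxC⟩) (a₂ := 0)
      (h0.trans (map_zero _).symm))
  have hle : L.comap D.mkQ ≤ D := hD.le_of_ge hLC (Submodule.le_comap_mkQ D L)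
  rw [← Submodule.map_comap_eq_of_surjective D.mkQ_surjective L]
  exact le_bot_iff.1 ((Submodule.map_mono hle).trans (by simp))

theorem IsEssentialIn.range_le_of_maximal {K C : Submodule R E} (hC : Maximal (IsEssentialIn K) C)
    {X : Type u} [AddCommGroup X] [Module R X] {φ : C →ₗ[R] X} {ψ : X →ₗ[R] E}
    (hφ : IsEssential (LinearMap.range φ)) (hψ : ψ ∘ₗ φ = C.subtype) : LinearMap.range ψ ≤ C := by
  replace hψ (c : C) : ψ (φ c) = c := LinearMap.congr_fun hψ c
  have hCψ : C ≤ LinearMap.range ψ := fun x hx ↦ ⟨φ ⟨x, hx⟩, hψ _⟩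
  refine hC.le_of_ge ⟨hC.prop.1.trans hCψ, fun L hL hLK ↦ ?_⟩ hCψ
  have hLC : L ⊓ C = ⊥ :=
    hC.prop.2 _ inf_le_right (le_bot_iff.1 (hLK ▸ inf_le_inf_right K inf_le_left))
  have hcomap : L.comap ψ = ⊥ := by
    refine hφ _ ((Submodule.eq_bot_iff _).2 ?_)
    rintro _ ⟨hx, c, rfl⟩
    have hc : (c : E) = 0 := (Submodule.eq_bot_iff _).1 hLC c ⟨by simpa [hψ] using hx, c.2⟩
    rw [Submodule.coe_eq_zero.1 hc, map_zero]
  rw [← Submodule.map_comap_eq_of_le hL, hcomap, Submodule.map_bot]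

theorem injective_of_maximal_isEssentialIn [Module.Injective R E] {K C : Submodule R E}
    (hC : Maximal (IsEssentialIn K) C) : Module.Injective R C := by
  obtain ⟨D, hD⟩ := exists_maximal_disjoint C
  obtain ⟨ψ, hψ⟩ := Module.Injective.extension_property R E C (E ⧸ D) _
    (mkQ_comp_subtype_injective hD.prop) C.subtype
  have hrange := IsEssentialIn.range_le_of_maximal hC (isEssential_range_mkQ_comp_subtype hD) hψ
  refine idLE_zero_iff.1 ((idLE_of_injective (M := E) 0).retract (i := C.subtype)
    (r := (ψ ∘ₗ D.mkQ).codRestrict C fun x ↦ hrange ⟨_, rfl⟩) (LinearMap.ext fun c ↦ ?_))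
  exact Subtype.ext (LinearMap.congr_fun hψ c)

theorem IsEssentialIn.isEssential_comap_subtype {K C : Submodule R E} (h : IsEssentialIn K C) :
    IsEssential (K.comap C.subtype) := by
  intro L hL
  have hmap : L.map C.subtype = ⊥ := h.2 _ (Submodule.map_subtype_le C L) <| by
    rw [Submodule.map_inf_eq_map_inf_comap, hL, Submodule.map_bot]
  exact Submodule.map_injective_of_injective C.injective_subtype
    (hmap.trans (Submodule.map_bot _).symm)

theorem exists_injective_envelope (M : ModuleCat.{u} R) :
    ∃ (E : ModuleCat.{u} R) (f : M →ₗ[R] E), Module.Injective R E ∧ Function.Injective f ∧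
      IsEssential (LinearMap.range f) := by
  obtain ⟨E, N, _, _, _, _, j, q, _, hj⟩ := exists_isSES_injective R M
  obtain ⟨C, hC⟩ := exists_maximal_isEssentialIn (LinearMap.range j)
  refine ⟨ModuleCat.of R C, j.codRestrict C fun x ↦ hC.prop.1 ⟨x, rfl⟩,
    injective_of_maximal_isEssentialIn hC,
    fun x y hxy ↦ hj.injective (congrArg Subtype.val hxy), ?_⟩
  rw [LinearMap.range_codRestrict]
  exact hC.prop.isEssential_comap_subtype

/-- An injective envelope of `M`. -/
noncomputable def envelope (M : ModuleCat.{u} R) : ModuleCat.{u} R :=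
  (exists_injective_envelope M).choose

/-- The embedding of `M` into its injective envelope. -/
noncomputable def toEnvelope (M : ModuleCat.{u} R) : M →ₗ[R] envelope M :=
  (exists_injective_envelope M).choose_spec.choose

instance injective_envelope (M : ModuleCat.{u} R) : Module.Injective R (envelope M) :=
  (exists_injective_envelope M).choose_spec.choose_spec.1

theorem toEnvelope_injective (M : ModuleCat.{u} R) : Function.Injective (toEnvelope M) :=
  (exists_injective_envelope M).choose_spec.choose_spec.2.1

theorem isEssential_range_toEnvelope (M : ModuleCat.{u} R) :
    IsEssential (LinearMap.range (toEnvelope M)) :=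
  (exists_injective_envelope M).choose_spec.choose_spec.2.2

/-- The iterated cosyzygies of `M`. -/
noncomputable def cosyzygy (M : ModuleCat.{u} R) : ℕ → ModuleCat.{u} R
  | 0 => M
  | i + 1 => ModuleCat.of R
      (envelope (cosyzygy M i) ⧸ LinearMap.range (toEnvelope (cosyzygy M i)))

/-- The projection from the injective envelope of a cosyzygy to the next cosyzygy. -/
noncomputable def toCosyzygy (M : ModuleCat.{u} R) (i : ℕ) :
    envelope (cosyzygy M i) →ₗ[R] cosyzygy M (i + 1) :=
  (LinearMap.range (toEnvelope (cosyzygy M i))).mkQ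

theorem isSES_cosyzygy (M : ModuleCat.{u} R) (i : ℕ) :
    IsSES (toEnvelope (cosyzygy M i)) (toCosyzygy M i) :=
  isSES_range (toEnvelope_injective _)

/-- The minimal injective coresolution obtained by splicing injective envelopes. -/
noncomputable def minimalInjectiveCoresolution (M : ModuleCat.{u} R) :
    MinimalInjectiveCoresolution M where
  E i := envelope (cosyzygy M i)
  ι := toEnvelope M
  d i := toEnvelope (cosyzygy M (i + 1)) ∘ₗ toCosyzygy M i
  injective i := injective_envelope _
  ι_injective := toEnvelope_injective M
  exact_zero x := by
    rw [LinearMap.comp_apply, map_eq_zero_iff _ (toEnvelope_injective _)]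
    exact (isSES_cosyzygy M 0).exact x
  exact_succ i x := by
    rw [LinearMap.comp_apply, map_eq_zero_iff _ (toEnvelope_injective _),
      (isSES_cosyzygy M (i + 1)).exact x, LinearMap.coe_comp,
      (isSES_cosyzygy M i).surjective.range_comp]
  essential_zero := isEssential_range_toEnvelope M
  essential_succ i := by
    rw [LinearMap.range_comp_of_range_eq_top _
      (LinearMap.range_eq_top.2 (isSES_cosyzygy M i).surjective)]
    exact isEssential_range_toEnvelope _

end Envelope

/-! ### Injective coresolutions by modules of bounded projective dimension -/

section Coresolution

variable {R : Type u} [Ring R]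

variable (R) in
/-- `M` has a partial injective coresolution `0 → M → E⁰ → ⋯ → Eⁿ⁻¹`, not necessarily minimal,
with `pd Eⁱ ≤ s + i`. -/
def CoresLE : ℕ → ℕ → ∀ (M : Type u) [AddCommGroup M] [Module R M], Prop
  | 0, _, _, _, _ => True
  | n + 1, s, M, _, _ => ∃ (E N : Type u) (_ : AddCommGroup E) (_ : Module R E)
      (_ : AddCommGroup N) (_ : Module R N) (f : M →ₗ[R] E) (g : E →ₗ[R] N),
      Module.Injective R E ∧ PdLE R s E ∧ IsSES f g ∧ CoresLE n (s + 1) N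

variable {A B C E M N P : Type u} [AddCommGroup A] [Module R A] [AddCommGroup B] [Module R B]
  [AddCommGroup C] [Module R C] [AddCommGroup E] [Module R E] [AddCommGroup M] [Module R M]
  [AddCommGroup N] [Module R N] [AddCommGroup P] [Module R P] {n s : ℕ}

namespace CoresLE

theorem mono {t : ℕ} (h : CoresLE R n s M) (hst : s ≤ t) : CoresLE R n t M := by
  induction n generalizing s t M with
  | zero => trivial
  | succ n ih =>
    obtain ⟨E, N, _, _, _, _, f, g, hE, hpd, hfg, hN⟩ := h
    exact ⟨E, N, _, _, _, _, f, g, hE, hpd.mono hst, hfg, ih hN (Nat.succ_le_succ hst)⟩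

theorem of_subsingleton [Subsingleton M] (n s : ℕ) : CoresLE R n s M := by
  induction n generalizing s with
  | zero => trivial
  | succ n ih =>
    have : Module.Injective R M := ⟨fun _ _ _ _ _ _ _ _ _ ↦ ⟨0, fun _ ↦ Subsingleton.elim _ _⟩⟩
    exact ⟨M, M, _, _, _, _, _, _, this, pdLE_of_projective s, isSES_id_zero, ih _⟩

theorem of_injective [hE : Module.Injective R E] (hpd : PdLE R s E) (n : ℕ) : CoresLE R n s E := by
  cases n with
  | zero => trivial
  | succ n =>
    exact ⟨E, PUnit, _, _, _, _, _, _, hE, hpd, isSES_id_zero, of_subsingleton _ _⟩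

theorem middle {α : A →ₗ[R] B} {β : B →ₗ[R] C} (h : IsSES α β) (hA : CoresLE R n s A)
    (hC : CoresLE R n s C) : CoresLE R n s B := by
  induction n generalizing s A B C with
  | zero => trivial
  | succ n ih =>
    obtain ⟨E, N, _, _, _, _, i, p, _, hpd, hip, hN⟩ := hA
    obtain ⟨E', N', _, _, _, _, i', p', _, hpd', hip', hN'⟩ := hC
    obtain ⟨j, φ, ψ, hj, hφψ⟩ := h.exists_isSES_horseshoe_injective hip hip'
    exact ⟨E × E', _, _, _, _, _, j, _, inferInstance, pdLE_prod_iff.2 ⟨hpd, hpd'⟩,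
      isSES_range hj, ih hφψ hN hN'⟩

theorem left {α : A →ₗ[R] B} {β : B →ₗ[R] C} (h : IsSES α β) (hB : CoresLE R (n + 1) s B)
    (hC : CoresLE R n (s + 1) C) : CoresLE R (n + 1) s A := by
  obtain ⟨E, N, _, _, _, _, f, g, hE, hpd, hfg, hN⟩ := hB
  have hA := isSES_range (f := f ∘ₗ α) (hfg.injective.comp h.injective)
  obtain ⟨φ, ψ, hφψ⟩ := h.exists_isSES_coker_comp hfg hA
  exact ⟨E, _, _, _, _, _, f ∘ₗ α, _, hE, hpd, hA, middle hφψ hC hN⟩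

theorem right {α : A →ₗ[R] B} {β : B →ₗ[R] C} (h : IsSES α β) (hA : CoresLE R (n + 1) s A)
    (hB : CoresLE R n (s + 1) B) : CoresLE R n (s + 1) C := by
  obtain ⟨E, N, _, _, _, _, f, g, _, hpd, hfg, hN⟩ := hA
  obtain ⟨F, hF⟩ := Module.Injective.extension_property R E A B α h.injective f
  obtain ⟨δ, hδ⟩ := h.exists_isSES_pushout hfg hF
  have hEC : CoresLE R n (s + 1) (E × C) := middle hδ hB hN
  cases n with
  | zero => trivial
  | succ n => exact left isSES_inr_fst hEC (of_injective (hpd.mono (by omega)) n)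

theorem of_isEssential (hM : CoresLE R (n + 1) s M) [Module.Injective R E] {ι : M →ₗ[R] E}
    {q : E →ₗ[R] N} (h : IsSES ι q) (hι : IsEssential (LinearMap.range ι)) :
    PdLE R s E ∧ CoresLE R n (s + 1) N := by
  obtain ⟨E', N', _, _, _, _, f, g, hE', hpd, hfg, hN⟩ := hM
  obtain ⟨ψ, rfl⟩ := Module.Injective.extension_property R E' M E ι h.injective f
  have hψ : Function.Injective ψ := hι.injective <| by
    rintro _ ⟨m, rfl⟩ hm
    rw [hfg.injective (hm.trans (map_zero _).symm), map_zero]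
  obtain ⟨e⟩ := (isSES_range hψ).nonempty_equiv_prod_of_injective
  obtain ⟨hpdE, hpdK⟩ := pdLE_prod_iff.1 (hpd.congr e)
  refine ⟨hpdE, ?_⟩
  cases n with
  | zero => trivial
  | succ n =>
    have := (injective_prod_iff.1 (idLE_zero_iff.1 ((idLE_zero_iff.2 hE').congr e))).2
    obtain ⟨φ, χ, hφχ⟩ := h.exists_isSES_coker_comp (isSES_range hψ) hfg
    exact left hφχ hN (of_injective (hpdK.mono (by omega)) n)

theorem of_coresolution {M : ModuleCat.{u} R} (D : MinimalInjectiveCoresolution M) (s n i : ℕ)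
    (hD : ∀ j, i ≤ j → j < i + n → PdLE R (s + j) (D.E j)) {f : N →ₗ[R] D.E i}
    (hf : Function.Injective f) (hfd : Function.Exact f (D.d i)) : CoresLE R n (s + i) N := by
  induction n generalizing i N with
  | zero => trivial
  | succ n ih =>
    have hs : IsSES f (D.d i).rangeRestrict :=
      ⟨hf, LinearMap.surjective_rangeRestrict _, fun x ↦ by simp [Subtype.ext_iff, ← hfd x]⟩
    refine ⟨D.E i, _, _, _, _, _, f, _, D.injective i, hD i le_rfl (by omega), hs,
      ih (i + 1) (fun j hij hj ↦ hD j (by omega) (by omega))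
        (LinearMap.range (D.d i)).injective_subtype fun x ↦ ?_⟩
    simp [D.exact_succ i x]

end CoresLE

theorem coresLE_cosyzygy {M : ModuleCat.{u} R} (hM : ∀ n, CoresLE R n s M) (i n : ℕ) :
    CoresLE R n (s + i) (cosyzygy M i) := by
  induction i generalizing n with
  | zero => exact hM n
  | succ i ih =>
    exact ((ih (n + 1)).of_isEssential (isSES_cosyzygy M i) (isEssential_range_toEnvelope _)).2

theorem pdLE_envelope_cosyzygy {M : ModuleCat.{u} R} (hM : ∀ n, CoresLE R n s M) (i : ℕ) :
    PdLE R (s + i) (envelope (cosyzygy M i)) :=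
  ((coresLE_cosyzygy hM i 1).of_isEssential (isSES_cosyzygy M i)
    (isEssential_range_toEnvelope _)).1

theorem gInftyClass_iff [IsSemiprimaryRing R] {M : ModuleCat.{u} R} :
    gInftyClass R s M ↔ ∀ n, CoresLE R n s M := by
  refine ⟨fun h n ↦ ?_, fun h n ↦ ⟨minimalInjectiveCoresolution M, fun i _ ↦
    (flatDimLE_iff_pdLE _).2 (pdLE_envelope_cosyzygy h i)⟩⟩
  obtain ⟨D, hD⟩ := h n
  exact .of_coresolution D s n 0
    (fun j _ hj ↦ (flatDimLE_iff_pdLE _).1 (hD j (by omega))) D.ι_injective D.exact_zero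

theorem exists_finset_forall_support_subset {ι : Type*} [Module.Finite R M] (g : M →ₗ[R] ι →₀ E) :
    ∃ t : Finset ι, ∀ x, (g x).support ⊆ t := by
  classical
  obtain ⟨S, hS⟩ : (⊤ : Submodule R M).FG := Module.Finite.fg_top
  let t : Finset ι := S.biUnion fun x ↦ (g x).support
  have hle : Submodule.span R (S : Set M) ≤ (Finsupp.supported E R (t : Set ι)).comap g :=
    Submodule.span_le.2 fun y hy ↦ (Finsupp.mem_supported R _).2 <| Finset.coe_subset.2 <|
      Finset.subset_biUnion_of_mem (fun x ↦ (g x).support) hy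
  exact ⟨t, fun x ↦ Finset.coe_subset.1 ((Finsupp.mem_supported R _).1 (hle (hS ▸ trivial)))⟩

instance injective_finsupp [IsNoetherianRing R] (ι : Type u) [hE : Module.Injective R E] :
    Module.Injective R (ι →₀ E) := by
  classical
  refine Module.Baer.injective fun I g ↦ ?_
  obtain ⟨t, ht⟩ := exists_finset_forall_support_subset g
  choose φ hφ using fun i ↦ Module.Baer.of_injective hE I (Finsupp.lapply i ∘ₗ g)
  refine ⟨∑ i ∈ t, Finsupp.lsingle i ∘ₗ φ i, fun x hx ↦ Finsupp.ext fun i ↦ ?_⟩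
  simp only [LinearMap.sum_apply, Finsupp.finsetSum_apply, LinearMap.comp_apply,
    Finsupp.lsingle_apply, Finsupp.single_apply, Finset.sum_ite_eq']
  split_ifs with hi
  · exact hφ i x hx
  · exact (Finsupp.notMem_support_iff.1 fun h ↦ hi (ht ⟨x, hx⟩ h)).symm

namespace CoresLE

theorem finsupp [IsNoetherianRing R] (ι : Type u) (h : CoresLE R n s M) :
    CoresLE R n s (ι →₀ M) := by
  induction n generalizing s M with
  | zero => trivial
  | succ n ih =>
    obtain ⟨E, N, _, _, _, _, f, g, hE, hpd, hfg, hN⟩ := h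
    exact ⟨ι →₀ E, ι →₀ N, _, _, _, _, _, _, inferInstance, hpd.finsupp ι, hfg.finsupp ι, ih hN⟩

theorem of_projective [IsNoetherianRing R] (hR : ∀ n, CoresLE R n 0 R) (n : ℕ)
    [hP : Module.Projective R P] : CoresLE R n 0 P := by
  induction n generalizing P with
  | zero => trivial
  | succ n ih =>
    obtain ⟨i, hi⟩ := Module.projective_lifting_property
      (Finsupp.linearCombination R (id : P → P)) LinearMap.id
      (Finsupp.linearCombination_id_surjective R P)
    have hs := isSES_range (f := i) (Function.LeftInverse.injective
      (g := Finsupp.linearCombination R (id : P → P)) (LinearMap.congr_fun hi))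
    obtain ⟨e⟩ := hs.nonempty_equiv_prod_of_retraction hi
    have := pdLE_zero_iff.1 (pdLE_prod_iff.1 ((pdLE_of_projective 0).congr e)).2
    exact left hs ((hR _).finsupp P) (ih.mono (by omega))

theorem of_pdLE [IsNoetherianRing R] (hR : ∀ n, CoresLE R n 0 R) (hM : PdLE R s M) (n : ℕ) :
    CoresLE R n s M := by
  induction s generalizing M n with
  | zero =>
    have := pdLE_zero_iff.1 hM
    exact of_projective hR n
  | succ s ih =>
    have hs := isSES_ker (Finsupp.linearCombination_id_surjective R M)
    exact right hs (ih (hs.pdLE_left (pdLE_of_projective s) hM) _)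
      ((of_projective hR n).mono (by omega))

theorem pdLE {d : ℕ} (hR : ∀ (X : Type u) [AddCommGroup X] [Module R X], PdLE R d X)
    (h : CoresLE R n s M) (hd : d ≤ s + n) : PdLE R s M := by
  induction n generalizing s M with
  | zero => exact (hR M).mono hd
  | succ n ih =>
    obtain ⟨E, N, _, _, _, _, f, g, -, hpd, hfg, hN⟩ := h
    exact hfg.pdLE_left hpd (ih hN (by omega))

end CoresLE

end Coresolution

/-! ### The dual of the Auslander condition -/

section DualCondition

variable {R : Type u} [Ring R]

variable (R) in
/-- There is an exact sequence `0 → P → Fₘ₋₁ → ⋯ → F₀ → N → 0` with all `Fᵢ` projective and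
`id Fᵢ ≤ t + i`. -/
def ResIdLE (P : Type u) [AddCommGroup P] [Module R P] :
    ℕ → ℕ → ∀ (N : Type u) [AddCommGroup N] [Module R N], Prop
  | 0, _, N, _, _ => Nonempty (P ≃ₗ[R] N)
  | m + 1, t, N, _, _ => ∃ (K F : Type u) (_ : AddCommGroup K) (_ : Module R K)
      (_ : AddCommGroup F) (_ : Module R F) (i : K →ₗ[R] F) (p : F →ₗ[R] N),
      Module.Projective R F ∧ IdLE R t F ∧ IsSES i p ∧ ResIdLE P m (t + 1) K

variable (R) in
/-- The dual Auslander condition in degree `i`: every module of injective dimension at most `i` is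
a quotient of a projective module of injective dimension at most `i`. -/
def CoverIdLE (i : ℕ) : Prop :=
  ∀ (K : Type u) [AddCommGroup K] [Module R K], IdLE R i K →
    ∃ (Y : Type u) (_ : AddCommGroup Y) (_ : Module R Y) (p : Y →ₗ[R] K),
      Module.Projective R Y ∧ IdLE R i Y ∧ Function.Surjective p

variable {A B C E K L M N N' P Q Y : Type u} [AddCommGroup A] [Module R A] [AddCommGroup B]
  [Module R B] [AddCommGroup C] [Module R C] [AddCommGroup E] [Module R E] [AddCommGroup K]
  [Module R K] [AddCommGroup L] [Module R L] [AddCommGroup M] [Module R M] [AddCommGroup N]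
  [Module R N] [AddCommGroup N'] [Module R N'] [AddCommGroup P] [Module R P] [AddCommGroup Q]
  [Module R Q] [AddCommGroup Y] [Module R Y] {m n t : ℕ}

namespace ResIdLE

theorem middle {α : A →ₗ[R] B} {β : B →ₗ[R] C} (h : IsSES α β) {t' : ℕ} (htt : t' ≤ t)
    (hA : ResIdLE R PUnit.{u + 1} m t A) (hC : ResIdLE R P m t' C) : ResIdLE R P m t B := by
  induction m generalizing A B C t t' with
  | zero =>
    obtain ⟨e⟩ := hA
    obtain ⟨e'⟩ := hC
    have : Subsingleton A := e.symm.toEquiv.subsingleton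
    have hβ : Function.Injective β := (injective_iff_map_eq_zero β).2 fun b hb ↦ by
      obtain ⟨a, rfl⟩ := (h.exact b).1 hb
      rw [Subsingleton.elim a 0, map_zero]
    exact ⟨e'.trans (LinearEquiv.ofBijective β ⟨hβ, h.surjective⟩).symm⟩
  | succ m ih =>
    obtain ⟨K, F, _, _, _, _, i, p, _, hid, hip, hK⟩ := hA
    obtain ⟨K', F', _, _, _, _, i', p', _, hid', hip', hK'⟩ := hC
    obtain ⟨π, φ, ψ, hπ, hφψ⟩ := h.exists_isSES_horseshoe_projective hip hip'
    exact ⟨LinearMap.ker π, F × F', _, _, _, _, _, π, inferInstance,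
      idLE_prod_iff.2 ⟨hid, hid'.mono htt⟩, isSES_ker hπ, ih hφψ (by omega) hK hK'⟩

theorem of_pdLE (hD : ∀ j < t + n, CoverIdLE R j) (hid : IdLE R t K) (hpd : PdLE R n K) :
    ResIdLE R PUnit.{u + 1} (n + 1) t K := by
  induction n generalizing t K with
  | zero => exact ⟨PUnit, K, _, _, _, _, _, _, pdLE_zero_iff.1 hpd, hid, isSES_zero_id, ⟨.refl R _⟩⟩
  | succ n ih =>
    obtain ⟨Y, _, _, p, hY, hYid, hp⟩ := hD t (by omega) K hid
    have hs := isSES_ker hp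
    exact ⟨_, Y, _, _, _, _, _, p, hY, hYid, hs, ih (fun j hj ↦ hD j (by omega))
      (hs.idLE_left (hYid.mono (by omega)) hid) (hs.pdLE_left (pdLE_of_projective n) hpd)⟩

theorem succ (hD : ∀ j < m, CoverIdLE R j) (hN : ResIdLE R P m 0 N) {f : N →ₗ[R] E}
    {g : E →ₗ[R] N'} (h : IsSES f g) (hE : Module.Injective R E) (hpd : PdLE R m E) :
    ResIdLE R P (m + 1) 0 N' := by
  obtain ⟨K, F, _, _, _, _, i, p, hF, hid, hip, hK⟩ :=
    of_pdLE (t := 0) (by simpa using hD) (idLE_zero_iff.2 hE) hpd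
  have hgp := isSES_ker (g := g ∘ₗ p) (h.surjective.comp hip.surjective)
  obtain ⟨φ, ψ, hφψ⟩ := hip.exists_isSES_ker_comp h hgp
  exact ⟨_, F, _, _, _, _, _, g ∘ₗ p, hF, hid, hgp, middle hφψ (Nat.zero_le _) hK hN⟩

theorem exists_of_coresLE (hD : ∀ j, j + 1 < m + n → CoverIdLE R j) (hN : ResIdLE R P m 0 N)
    (hc : CoresLE R n m N) :
    ∃ (N' : Type u) (_ : AddCommGroup N') (_ : Module R N'), ResIdLE R P (m + n) 0 N' := by
  induction n generalizing m N with
  | zero => exact ⟨N, _, _, hN⟩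
  | succ n ih =>
    obtain ⟨E, N', _, _, _, _, f, g, hE, hpd, hfg, hN'⟩ := hc
    rw [← Nat.add_assoc, Nat.add_right_comm]
    exact ih (fun j hj ↦ hD j (by omega)) (hN.succ (fun j hj ↦ hD j (by omega)) hfg hE hpd) hN'

theorem exists_left (hN : ResIdLE R P (m + 1) t N) :
    ∃ (F C : Type u) (_ : AddCommGroup F) (_ : Module R F) (_ : AddCommGroup C) (_ : Module R C)
      (a : P →ₗ[R] F) (b : F →ₗ[R] C), Module.Projective R F ∧ IdLE R (t + m) F ∧ IsSES a b ∧
      ResIdLE R C m t N := by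
  induction m generalizing t N with
  | zero =>
    obtain ⟨K, F, _, _, _, _, i, p, hF, hid, hip, ⟨e⟩⟩ := hN
    exact ⟨F, N, _, _, _, _, _, p, hF, hid, hip.comp_equiv e, ⟨.refl R N⟩⟩
  | succ m ih =>
    obtain ⟨K, F, _, _, _, _, i, p, hF, hid, hip, hK⟩ := hN
    obtain ⟨F', C, _, _, _, _, a, b, hF', hid', hab, hC⟩ := ih hK
    rw [Nat.add_right_comm] at hid'
    exact ⟨F', C, _, _, _, _, a, b, hF', hid', hab, K, F, _, _, _, _, i, p, hF, hid, hip, hC⟩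

theorem subsingleton_ext (hC : ResIdLE R C n t N) {j : ℕ} (hK : IdLE R (n + j) K) :
    Subsingleton (Abelian.Ext (ModuleCat.of R C) (ModuleCat.of R K) (j + 1)) := by
  induction n generalizing C j with
  | zero =>
    rw [Nat.zero_add] at hK
    have : HasInjectiveDimensionLT (ModuleCat.of R K) (j + 1) := hK
    exact HasInjectiveDimensionLT.subsingleton _ (j + 1) _ le_rfl _
  | succ n ih =>
    obtain ⟨F, C', _, _, _, _, a, b, _, -, hab, hC'⟩ := hC.exists_left
    rw [Nat.add_right_comm] at hK
    have := ih hC' (j := j + 1) hK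
    exact hab.subsingleton_ext_of_projective j

theorem coresLE [IsNoetherianRing R] (hR : ∀ n, CoresLE R n 0 R) (hC : ResIdLE R C n t N) :
    CoresLE R n 0 C := by
  induction n generalizing C with
  | zero => trivial
  | succ n ih =>
    obtain ⟨F, C', _, _, _, _, a, b, hF, -, hab, hC'⟩ := hC.exists_left
    exact .left hab (.of_projective hR _) ((ih hC').mono (by omega))

end ResIdLE

theorem exists_projective_embedding [IsNoetherianRing R] (hR : ∀ n, CoresLE R n 0 R) {i : ℕ}
    (hD : ∀ j < i, CoverIdLE R j) (P : Type u) [AddCommGroup P] [Module R P]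
    [Module.Projective R P] :
    ∃ (Y C N : Type u) (_ : AddCommGroup Y) (_ : Module R Y) (_ : AddCommGroup C) (_ : Module R C)
      (_ : AddCommGroup N) (_ : Module R N)
      (a : P →ₗ[R] Y) (b : Y →ₗ[R] C), Module.Projective R Y ∧ IdLE R i Y ∧ IsSES a b ∧
      ResIdLE R C i 0 N := by
  obtain ⟨N, _, _, hN⟩ := ResIdLE.exists_of_coresLE (m := 0) (n := i + 1) (P := P) (N := P)
    (fun j hj ↦ hD j (by omega)) ⟨.refl R P⟩ (.of_projective hR _)
  rw [Nat.zero_add] at hN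
  obtain ⟨Y, C, _, _, _, _, a, b, hY, hid, hab, hC⟩ := hN.exists_left
  rw [Nat.zero_add] at hid
  exact ⟨Y, C, N, _, _, _, _, _, _, a, b, hY, hid, hab, hC⟩

theorem coverIdLE [IsNoetherianRing R] (hR : ∀ n, CoresLE R n 0 R) (i : ℕ) : CoverIdLE R i := by
  induction i using Nat.strong_induction_on with
  | _ i ih =>
    intro K _ _ hK
    obtain ⟨Y, C, N, _, _, _, _, _, _, a, b, hY, hid, hab, hC⟩ :=
      exists_projective_embedding hR ih (K →₀ R)
    have := hC.subsingleton_ext (j := 0) hK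
    obtain ⟨ψ, hψ⟩ := hab.exists_extension_of_subsingleton_ext (Finsupp.linearCombination R id)
    exact ⟨Y, _, _, ψ, hY, hid, .of_comp (g := a) <| by
      simpa only [← LinearMap.coe_comp, hψ] using Finsupp.linearCombination_id_surjective R K⟩

theorem exists_sum_smul_eq [hY : Module.Projective R Y] (y : Y) (T : Finset R)
    (hT : ∀ f : Y →ₗ[R] R, f y ∈ Submodule.span Rᵐᵒᵖ (T : Set R)) :
    ∃ v : R → Y, ∑ a ∈ T, a • v a = y := by
  obtain ⟨s, hs⟩ := hY.out
  have exists_sum_eq_smul (c : R) (hc : c ∈ Submodule.span Rᵐᵒᵖ (T : Set R)) (z : Y) :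
      ∃ v : R → Y, ∑ a ∈ T, a • v a = c • z := by
    obtain ⟨b, -, rfl⟩ := Submodule.mem_span_finset.1 hc
    refine ⟨fun a ↦ (b a).unop • z, ?_⟩
    simp only [Finset.sum_smul, ← mul_smul]
    rfl
  rw [← hs y, Finsupp.linearCombination_apply, Finsupp.sum]
  refine Finset.sum_induction _ (fun w ↦ ∃ v : R → Y, ∑ a ∈ T, a • v a = w) ?_ ?_ ?_
  · rintro _ _ ⟨v, rfl⟩ ⟨w, rfl⟩
    exact ⟨v + w, by simp only [Pi.add_apply, smul_add, Finset.sum_add_distrib]⟩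
  · exact ⟨0, by simp⟩
  · exact fun z _ ↦ exists_sum_eq_smul _ (hT (Finsupp.lapply z ∘ₗ s)) _

theorem CoresLE.of_factorization [IsNoetherianRing R] (hR : ∀ n, CoresLE R n 0 R)
    [Module.Projective R Q] [Module.Projective R Y] {u : A →ₗ[R] Y} {b : Y →ₗ[R] C}
    (hub : IsSES u b) {h : A →ₗ[R] Q} {q : Q →ₗ[R] L} (hhq : IsSES h q) {g : Q →ₗ[R] Y}
    (hg : g ∘ₗ h = u) (hC : CoresLE R n 0 C) : CoresLE R n 0 L := by
  obtain ⟨ψ, hψ⟩ := hhq.exists_isSES_pushout hub hg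
  have hYL : CoresLE R n 0 (Y × L) := middle hψ (of_projective hR n) hC
  cases n with
  | zero => trivial
  | succ n => exact left isSES_inr_fst hYL ((of_projective hR n).mono (by omega))

theorem exists_finset_forall_factorization [IsNoetherianRing Rᵐᵒᵖ] {ι : Type*} {Y : ι → Type u}
    [∀ j, AddCommGroup (Y j)] [∀ j, Module R (Y j)] [∀ j, Module.Projective R (Y j)]
    (u : ∀ j, R →ₗ[R] Y j) :
    ∃ (T : Finset R) (i : T → ι) (f : ∀ a, Y (i a) →ₗ[R] R),
      ∀ j, ∃ g : (T → R) →ₗ[R] Y j, g ∘ₗ LinearMap.pi (fun a ↦ f a ∘ₗ u (i a)) = u j := by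
  let S : Set R := {r | ∃ (j : ι) (f : Y j →ₗ[R] R), f (u j 1) = r}
  have : IsNoetherian Rᵐᵒᵖ R :=
    isNoetherian_of_linearEquiv (MulOpposite.opLinearEquiv Rᵐᵒᵖ : R ≃ₗ[Rᵐᵒᵖ] Rᵐᵒᵖ).symm
  obtain ⟨T, hTS, hT⟩ := Submodule.fg_span_iff_fg_span_finset_subset (R := Rᵐᵒᵖ) S |>.1
    (IsNoetherian.noetherian _)
  choose i f hf using fun a : T ↦ hTS a.2
  refine ⟨T, i, f, fun j ↦ ?_⟩
  obtain ⟨v, hv⟩ := exists_sum_smul_eq (u j 1) T fun f ↦ hT ▸ Submodule.subset_span ⟨j, f, rfl⟩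
  refine ⟨∑ a : T, LinearMap.toSpanSingleton R (Y j) (v a) ∘ₗ LinearMap.proj a, ?_⟩
  ext
  rw [← hv, ← Finset.sum_coe_sort T]
  simp [hf]

theorem exists_idLE_self [IsNoetherianRing R] [IsNoetherianRing Rᵐᵒᵖ] (hR : ∀ n, CoresLE R n 0 R)
    (hproj : ∀ (L : Type u) [AddCommGroup L] [Module R L] [Module.Finite R L],
      (∀ n, CoresLE R n 0 L) → Module.Projective R L) : ∃ d, IdLE R d R := by
  choose Y C N _ _ _ _ _ _ u b hY hid hub hC using fun i ↦
    exists_projective_embedding hR (i := i) (fun j _ ↦ coverIdLE hR j) R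
  obtain ⟨T, i, f, hfac⟩ := exists_finset_forall_factorization u
  choose g hg using hfac
  let h : R →ₗ[R] (T → R) := LinearMap.pi fun a ↦ f a ∘ₗ u (i a)
  have hs : IsSES h (LinearMap.range h).mkQ := isSES_range <|
    Function.Injective.of_comp (f := g 0) <| by
      rw [← LinearMap.coe_comp, hg]
      exact (hub 0).injective
  have hcoker := hproj _ fun n ↦ .of_factorization hR (hub n) hs (hg n) ((hC n).coresLE hR)
  obtain ⟨r, hr⟩ := hs.exists_retraction_of_projective
  have hpi : IdLE R (Finset.univ.sup i) (∀ a, Y (i a)) :=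
    .pi fun a ↦ (hid (i a)).mono (Finset.le_sup (Finset.mem_univ a))
  exact ⟨_, hpi.retract (i := LinearMap.pi fun a ↦ u (i a))
    (r := r ∘ₗ LinearMap.pi fun a ↦ f a ∘ₗ LinearMap.proj a) hr⟩

end DualCondition

/-! ### Essential extensions over Artin algebras -/

section EssentialExtension

variable {k : Type v} [CommRing k] {R : Type u} [Ring R] [Algebra k R] {E : Type u}
  [AddCommGroup E] [Module R E]

theorem IsEssential.le_of_isSemisimpleModule {K : Submodule R E} (hK : IsEssential K)
    (T : Submodule R E) [IsSemisimpleModule R T] : T ≤ K := by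
  obtain ⟨C, hC⟩ := exists_isCompl (K.comap T.subtype)
  have hCK : C.map T.subtype ⊓ K = ⊥ := by
    rw [Submodule.map_inf_eq_map_inf_comap, inf_comm, hC.inf_eq_bot, Submodule.map_bot]
  have hbot : C = ⊥ := Submodule.map_injective_of_injective T.injective_subtype
    ((hK _ hCK).trans (Submodule.map_bot _).symm)
  rw [← T.range_subtype, LinearMap.range_eq_map, Submodule.map_le_iff_le_comap, ← hC.sup_eq_top,
    hbot, sup_bot_eq]

theorem IsEssential.mem_of_forall_jacobson_smul_eq_zero [IsSemiprimaryRing R] {K : Submodule R E}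
    (hK : IsEssential K) {x : E} (hx : ∀ r ∈ Ring.jacobson R, r • x = 0) : x ∈ K := by
  have : IsSemisimpleModule R (R ∙ x) := by
    refine isSemisimpleModule_of_isTorsionBySet_jacobson fun ⟨y, hy⟩ ⟨r, hr⟩ ↦ Subtype.ext ?_
    obtain ⟨a, rfl⟩ := Submodule.mem_span_singleton.1 hy
    exact (smul_smul r a x).trans (hx _ (Ideal.mul_mem_right _ _ hr))
  exact hK.le_of_isSemisimpleModule _ (Submodule.mem_span_singleton_self x)

section ScalarTower

variable [Module k E] [IsScalarTower k R E]

variable (k E) in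
/-- The elements of `E` killed by the left ideal `I`. They form only a `k`-submodule of `E` when
`I` is not two-sided. -/
def annihilatedBy (I : Ideal R) : Submodule k E :=
  ⨅ r ∈ I, LinearMap.ker (Algebra.lsmul k k E r)

theorem mem_annihilatedBy {I : Ideal R} {x : E} :
    x ∈ annihilatedBy k E I ↔ ∀ r ∈ I, r • x = 0 := by
  simp [annihilatedBy, Submodule.mem_iInf]

theorem fg_annihilatedBy_mul [IsNoetherianRing k] {I J : Ideal R} (hJ : J.FG)
    (hEI : (annihilatedBy k E I).FG) (hEJ : (annihilatedBy k E J).FG) :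
    (annihilatedBy k E (I * J)).FG := by
  obtain ⟨G, rfl⟩ := hJ
  let f : E →ₗ[k] (G → E) := LinearMap.pi fun a ↦ Algebra.lsmul k k E (a : R)
  refine Submodule.fg_of_fg_map_of_fg_inf_ker f ?_ ?_
  · refine (Submodule.fg_pi fun _ : G ↦ hEI).of_le ?_
    rintro _ ⟨x, hx, rfl⟩ a -
    refine mem_annihilatedBy.2 fun r hr ↦ (smul_smul r (a : R) x).trans ?_
    exact mem_annihilatedBy.1 hx _ (Ideal.mul_mem_mul hr (Submodule.subset_span a.2))
  · refine hEJ.of_le fun x ⟨_, hx⟩ ↦ mem_annihilatedBy.2 fun r hr ↦ ?_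
    have hG : Ideal.span (G : Set R) ≤ LinearMap.ker (LinearMap.toSpanSingleton R E x) :=
      Submodule.span_le.2 fun a ha ↦ congrFun hx ⟨a, ha⟩
    exact hG hr

theorem fg_annihilatedBy_pow [IsNoetherianRing k] {J : Ideal R} [J.IsTwoSided]
    (hJ : ∀ n, (J ^ n).FG)
    (hEJ : (annihilatedBy k E J).FG) (n : ℕ) : (annihilatedBy k E (J ^ n)).FG := by
  induction n with
  | zero =>
    have hbot : annihilatedBy k E (J ^ 0) = ⊥ := by
      refine eq_bot_iff.2 fun x hx ↦ ?_
      simpa using mem_annihilatedBy.1 hx 1 (by simp [Submodule.pow_zero, Ideal.one_eq_top])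
    rw [hbot]
    exact Submodule.fg_bot
  | succ n ih =>
    rw [Ideal.IsTwoSided.pow_succ]
    exact fg_annihilatedBy_mul (hJ n) hEJ ih

end ScalarTower

variable (k) in
theorem IsEssential.finite [IsArtinianRing k] [Module.Finite k R] {K : Submodule R E}
    (hK : IsEssential K) (hfg : K.FG) : Module.Finite R E := by
  let _ : Module k E := Module.compHom E (algebraMap k R)
  have : IsScalarTower k R E := IsScalarTower.of_compHom k R E
  have : IsArtinianRing R := .of_finite k R
  have : Module.Finite R K := Module.Finite.iff_fg.2 hfg
  have : Module.Finite k K := Module.Finite.trans R K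
  have hKk : (K.restrictScalars k).FG := Module.Finite.iff_fg.1 ‹Module.Finite k K›
  have hE := fg_annihilatedBy_pow (J := Ring.jacobson R) (fun _ ↦ IsNoetherian.noetherian _)
    (hKk.of_le fun x hx ↦ hK.mem_of_forall_jacobson_smul_eq_zero (mem_annihilatedBy.1 hx))
  obtain ⟨n, hn⟩ := IsSemiprimaryRing.isNilpotent (R := R)
  have htop : annihilatedBy k E (Ring.jacobson R ^ n) = ⊤ := by
    refine eq_top_iff.2 fun x _ ↦ mem_annihilatedBy.2 fun r hr ↦ ?_
    rw [hn, Ideal.zero_eq_bot, Ideal.mem_bot] at hr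
    rw [hr, zero_smul]
  have : Module.Finite k E := ⟨htop ▸ hE n⟩
  exact Module.Finite.of_restrictScalars_finite k R E

end EssentialExtension

/-! ### Simple modules and their projective covers -/

section Simple

variable {R : Type u} [Ring R]

theorem exists_hom_quotient {M : Type u} [AddCommGroup M] [Module R M] {I : Ideal R}
    (hI : I ≤ Module.annihilator R M) (m : M) :
    ∃ f : R ⧸ I →ₗ[R] M, ∀ r : R, f (Submodule.Quotient.mk r) = r • m :=
  ⟨I.liftQ (LinearMap.toSpanSingleton R M m) fun _ hr ↦ Module.mem_annihilator.1 (hI hr) m,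
    fun _ ↦ rfl⟩

theorem isSemisimpleModule_quotient_of_jacobson_le [IsSemiprimaryRing R] {I : Ideal R}
    (hI : Ring.jacobson R ≤ I) : IsSemisimpleModule R (R ⧸ I) :=
  isSemisimpleModule_of_isTorsionBySet_jacobson <| (Module.isTorsionBySet_quotient_iff _ _).2
    fun _ _ hr ↦ hI (Ideal.mul_mem_right _ _ hr)

theorem exists_linearEquiv_of_iInf_annihilator_le [IsSemiprimaryRing R] {κ : Type*} {T : κ → Type u}
    [∀ j, AddCommGroup (T j)] [∀ j, Module R (T j)] [∀ j, IsSimpleModule R (T j)] {S : Type u}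
    [AddCommGroup S] [Module R S] [IsSimpleModule R S]
    (h : ⨅ j, Module.annihilator R (T j) ≤ Module.annihilator R S) :
    ∃ j, Nonempty (S ≃ₗ[R] T j) := by
  set I : Ideal R := ⨅ j, Module.annihilator R (T j) with hI
  have hJI : Ring.jacobson R ≤ I :=
    le_iInf fun j ↦ IsSemisimpleModule.jacobson_le_annihilator R (T j)
  have := isSemisimpleModule_quotient_of_jacobson_le hJI
  have := IsSimpleModule.nontrivial R S
  obtain ⟨s, hs⟩ := exists_ne (0 : S)
  obtain ⟨f, hf⟩ := exists_hom_quotient h s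
  have hf0 : f ≠ 0 := fun h0 ↦ hs <| by rw [← one_smul R s, ← hf, h0, LinearMap.zero_apply]
  obtain ⟨σ, hσ⟩ := IsSemisimpleModule.lifting_property f (LinearMap.surjective_of_ne_zero hf0) .id
  obtain ⟨r, hr⟩ := Submodule.Quotient.mk_surjective I (σ s)
  have hrI : r ∉ I := fun hrI ↦ hs <| by
    rw [← LinearMap.id_apply (R := R) s, ← hσ, LinearMap.comp_apply, ← hr,
      (Submodule.Quotient.mk_eq_zero I).2 hrI, map_zero]
  simp only [hI, Submodule.mem_iInf, Module.mem_annihilator, not_forall] at hrI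
  obtain ⟨j, v, hv⟩ := hrI
  obtain ⟨g, hg⟩ := exists_hom_quotient (iInf_le (fun j ↦ Module.annihilator R (T j)) j) v
  have hgσ : g ∘ₗ σ ≠ 0 := fun h0 ↦ hv <| by
    rw [← hg r, hr, ← LinearMap.comp_apply, h0, LinearMap.zero_apply]
  exact ⟨j, ⟨.ofBijective _ (LinearMap.bijective_of_ne_zero hgσ)⟩⟩

variable (R) in
/-- A family of representatives of the isomorphism classes of simple modules. -/
structure SimpleFamily (ι : Type) where
  S : ι → ModuleCat.{u} R
  simple : ∀ i, IsSimpleModule R (S i)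
  eq_of_equiv : ∀ i j, Nonempty (S i ≃ₗ[R] S j) → i = j
  exists_equiv : ∀ (M : Type u) [AddCommGroup M] [Module R M] [IsSimpleModule R M],
    ∃ i, Nonempty (S i ≃ₗ[R] M)

variable (R) in
theorem exists_simpleFamily [IsArtinianRing R] :
    ∃ (ι : Type) (_ : Finite ι), Nonempty (SimpleFamily R ι) := by
  have := isSemisimpleModule_quotient_of_jacobson_le (le_refl (Ring.jacobson R))
  obtain ⟨n, T, e, hT⟩ := IsSemisimpleModule.exists_linearEquiv_fin_dfinsupp R (R ⧸ Ring.jacobson R)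
  have hann : ⨅ j, Module.annihilator R (T j) = Ring.jacobson R := by
    rw [← Module.annihilator_dfinsupp, ← e.annihilator_eq, Ideal.annihilator_quotient]
  let r : Setoid (Fin n) :=
    { r := fun i j ↦ Nonempty (T i ≃ₗ[R] T j)
      iseqv := ⟨fun i ↦ ⟨.refl R _⟩, fun ⟨e⟩ ↦ ⟨e.symm⟩, fun ⟨e⟩ ⟨e'⟩ ↦ ⟨e.trans e'⟩⟩ }
  refine ⟨Quotient r, inferInstance, ⟨⟨fun q ↦ ModuleCat.of R (T q.out), fun q ↦ hT q.out,
    fun i j h ↦ ?_, fun M _ _ _ ↦ ?_⟩⟩⟩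
  · rw [← i.out_eq, ← j.out_eq]
    exact Quotient.sound h
  · obtain ⟨j, ⟨eM⟩⟩ := exists_linearEquiv_of_iInf_annihilator_le
      (hann.trans_le (IsSemisimpleModule.jacobson_le_annihilator R M))
    obtain ⟨ej⟩ : Nonempty (T (Quotient.mk r j).out ≃ₗ[R] T j) := Quotient.mk_out (s := r) j
    exact ⟨Quotient.mk r j, ⟨ej.trans eM.symm⟩⟩

/-- Fitting's lemma for right multiplication by `x`. -/
theorem exists_isIdempotentElem_mem_span_singleton [IsArtinianRing R] (x : R) :
    ∃ e ∈ Ideal.span {x}, IsIdempotentElem e ∧ ∃ n, x ^ n * e = x ^ n := by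
  let φ : Module.End R R := RingEquiv.moduleEndSelf R (.op x)
  have hφ (n : ℕ) (r : R) : (φ ^ n) r = r * x ^ n := by
    simp only [φ, ← map_pow, ← MulOpposite.op_pow]
    rfl
  obtain ⟨n, hn, hn1⟩ := (φ.eventually_isCompl_ker_pow_range_pow.and
    (Filter.eventually_ge_atTop 1)).exists
  let π := (LinearMap.range (φ ^ n)).projection _ hn.symm
  have hπ {y : R} (hy : y ∈ LinearMap.range (φ ^ n)) : y * π 1 = y := by
    rw [← smul_eq_mul, ← map_smul, smul_eq_mul, mul_one]
    exact Submodule.projection_apply_of_mem_left _ hy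
  obtain ⟨s, hs⟩ := Submodule.projection_apply_mem hn.symm (1 : R)
  refine ⟨π 1, Ideal.mem_span_singleton'.2 ⟨s * x ^ (n - 1), ?_⟩, hπ ⟨s, hs⟩, n,
    hπ ⟨1, by rw [hφ, one_mul]⟩⟩
  rw [mul_assoc, pow_sub_one_mul (by lia), ← hφ, hs]

theorem projective_span_singleton {e : R} (he : IsIdempotentElem e) :
    Module.Projective R (Ideal.span {e}) := by
  refine .of_split (Ideal.span {e}).subtype ((LinearMap.toSpanSingleton R R e).codRestrict _
    fun r ↦ Ideal.mul_mem_left _ r (Ideal.mem_span_singleton_self e)) (LinearMap.ext fun p ↦ ?_)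
  obtain ⟨a, ha⟩ := Ideal.mem_span_singleton'.1 p.2
  refine Subtype.ext ?_
  change (p : R) * e = p
  rw [← ha, mul_assoc, he.eq]

namespace SimpleFamily

variable {ι : Type} (𝒮 : SimpleFamily R ι)

instance (i : ι) : IsSimpleModule R (𝒮.S i) := 𝒮.simple i

theorem exists_smul_eq_self [IsSemiprimaryRing R] (i : ι) :
    ∃ x : R, (∀ j ≠ i, ∀ v : 𝒮.S j, x • v = 0) ∧ ∃ v : 𝒮.S i, v ≠ 0 ∧ x • v = v := by
  have hann : ¬ ⨅ j : {j // j ≠ i}, Module.annihilator R (𝒮.S j) ≤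
      Module.annihilator R (𝒮.S i) := fun h ↦ by
    obtain ⟨j, hj⟩ := exists_linearEquiv_of_iInf_annihilator_le h
    exact j.2 (𝒮.eq_of_equiv i j hj).symm
  obtain ⟨r, hr, hri⟩ := SetLike.not_le_iff_exists.1 hann
  simp only [Submodule.mem_iInf, Module.mem_annihilator, Subtype.forall, not_forall] at hr hri
  obtain ⟨v, hv⟩ := hri
  obtain ⟨b, hb⟩ := IsSimpleModule.toSpanSingleton_surjective R hv v
  refine ⟨b * r, fun j hj w ↦ by rw [mul_smul, hr j hj, smul_zero], v, ?_, ?_⟩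
  · rintro rfl
    exact hv (smul_zero r)
  · rwa [mul_smul]

theorem exists_projective [IsArtinianRing R] (i : ι) :
    ∃ (P : Type u) (_ : AddCommGroup P) (_ : Module R P), Module.Projective R P ∧
      Module.Finite R P ∧ (∀ j ≠ i, ∀ f : P →ₗ[R] 𝒮.S j, f = 0) ∧
      ∃ f : P →ₗ[R] 𝒮.S i, f ≠ 0 := by
  obtain ⟨x, hx, v, hv, hxv⟩ := 𝒮.exists_smul_eq_self i
  obtain ⟨e, hex, he, n, hn⟩ := exists_isIdempotentElem_mem_span_singleton x
  obtain ⟨r, rfl⟩ := Ideal.mem_span_singleton'.1 hex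
  let ε : Ideal.span {r * x} := ⟨r * x, Ideal.mem_span_singleton_self _⟩
  refine ⟨Ideal.span {r * x}, _, _, projective_span_singleton he, inferInstance, fun j hj f ↦ ?_,
    LinearMap.toSpanSingleton R _ v ∘ₗ Submodule.subtype _, fun h0 ↦ hv ?_⟩
  · have hfε : f ε = 0 :=
      calc f ε = f ((r * x) • ε) := congrArg f (Subtype.ext he.eq.symm)
        _ = 0 := by rw [map_smul, mul_smul, hx j hj, smul_zero]
    ext p
    obtain ⟨a, ha⟩ := Ideal.mem_span_singleton'.1 p.2
    obtain rfl : p = a • ε := Subtype.ext ha.symm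
    rw [map_smul, hfε, smul_zero, LinearMap.zero_apply]
  · have hpow : x ^ n • v = v := by rw [← smul_iterate_apply, Function.iterate_fixed hxv]
    calc v = (x ^ n * (r * x)) • v := by rw [hn, hpow]
      _ = 0 := by
        rw [mul_smul, show (r * x) • v = 0 from LinearMap.congr_fun h0 ε, smul_zero]

end SimpleFamily

theorem isNoetherian_end (k : Type v) [CommRing k] [IsNoetherianRing k] [Algebra k R]
    [Module.Finite k R] (S : Type u) [AddCommGroup S] [Module R S] [Module.Finite R S] :
    IsNoetherian (Module.End R S) S := by
  let _ : Module k S := Module.compHom S (algebraMap k R)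
  have : IsScalarTower k R S := IsScalarTower.of_compHom k R S
  have : Module.Finite k S := Module.Finite.trans R S
  have : IsScalarTower k (Module.End R S) S := ⟨fun _ _ _ ↦ rfl⟩
  exact isNoetherian_of_tower k inferInstance

theorem isNoetherian_hom (P S : Type u) [AddCommGroup P] [Module R P]
    [Module.Finite R P] [AddCommGroup S] [Module R S] [IsNoetherian (Module.End R S) S] :
    IsNoetherian (Module.End R S) (P →ₗ[R] S) := by
  obtain ⟨n, f, hf⟩ := Module.Finite.exists_fin' R P
  let evalBasis : (P →ₗ[R] S) →ₗ[Module.End R S] (Fin n → S) :=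
    { toFun := fun φ i ↦ φ (f (Pi.single i 1))
      map_add' := fun _ _ ↦ rfl
      map_smul' := fun _ _ ↦ rfl }
  refine isNoetherian_of_injective evalBasis fun φ ψ h ↦ ?_
  refine (LinearMap.cancel_right hf).1 (LinearMap.pi_ext' fun i ↦ ?_)
  exact LinearMap.ext_ring (congrFun h i)

end Simple

/-! ### Euler characteristics of modules of finite projective dimension -/

section Euler

variable {R : Type u} [Ring R] {ι : Type} (𝒮 : SimpleFamily R ι)

namespace SimpleFamily

/-- The class in `K₀` of a finitely generated projective module `P`, encoded by the dimensions of
the spaces `Hom(P, Sᵢ)` over the division rings `End(Sᵢ)`. -/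
noncomputable def topRank (P : Type u) [AddCommGroup P] [Module R P] : ι → ℚ := fun i ↦
  Module.finrank (Module.End R (𝒮.S i)) (P →ₗ[R] 𝒮.S i)

/-- `𝒮.HasEuler M x`: there is a finite resolution of `M` by finitely generated projective modules
in which the alternating sum of the top ranks is `x`. -/
inductive HasEuler : ∀ (M : Type u) [AddCommGroup M] [Module R M], (ι → ℚ) → Prop
  | of_subsingleton (M : Type u) [AddCommGroup M] [Module R M] [Subsingleton M] : HasEuler M 0
  | of_resolution {K F M : Type u} [AddCommGroup K] [Module R K] [AddCommGroup F] [Module R F]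
      [AddCommGroup M] [Module R M] [Module.Projective R F] [Module.Finite R F] {i : K →ₗ[R] F}
      {p : F →ₗ[R] M} {y : ι → ℚ} (h : IsSES i p) (hK : HasEuler K y) :
      HasEuler M (𝒮.topRank F - y)

variable {A B C E M N P Q : Type u} [AddCommGroup A] [Module R A] [AddCommGroup B] [Module R B]
  [AddCommGroup C] [Module R C] [AddCommGroup E] [Module R E] [AddCommGroup M] [Module R M]
  [AddCommGroup N] [Module R N] [AddCommGroup P] [Module R P] [AddCommGroup Q] [Module R Q]
  {x y : ι → ℚ}

theorem topRank_congr (e : P ≃ₗ[R] Q) : 𝒮.topRank P = 𝒮.topRank Q := by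
  funext i
  let e' : (P →ₗ[R] 𝒮.S i) ≃ₗ[Module.End R (𝒮.S i)] (Q →ₗ[R] 𝒮.S i) :=
    { toFun := fun f ↦ f ∘ₗ e.symm.toLinearMap
      invFun := fun f ↦ f ∘ₗ e.toLinearMap
      left_inv := fun f ↦ by ext; simp
      right_inv := fun f ↦ by ext; simp
      map_add' := fun _ _ ↦ rfl
      map_smul' := fun _ _ ↦ rfl }
  exact congrArg Nat.cast e'.finrank_eq

theorem topRank_of_subsingleton [Subsingleton P] : 𝒮.topRank P = 0 := by
  classical
  funext i
  simp only [topRank, Module.finrank_zero_of_subsingleton, Nat.cast_zero, Pi.zero_apply]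

variable {𝒮}

namespace HasEuler

theorem congr (h : 𝒮.HasEuler M x) (e : M ≃ₗ[R] N) : 𝒮.HasEuler N x := by
  cases h with
  | of_subsingleton =>
    have : Subsingleton N := e.symm.toEquiv.subsingleton
    exact .of_subsingleton N
  | of_resolution hip hK => exact .of_resolution (hip.equiv_comp e) hK

variable (𝒮 P) in
theorem of_projective [Module.Projective R P] [Module.Finite R P] :
    𝒮.HasEuler P (𝒮.topRank P) := by
  simpa only [sub_zero] using of_resolution isSES_zero_id (.of_subsingleton PUnit)

end HasEuler

theorem exists_hasEuler [IsNoetherianRing R] {r : ℕ} [Module.Finite R M] (hM : PdLE R r M) :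
    ∃ x, 𝒮.HasEuler M x := by
  induction r generalizing M with
  | zero =>
    have := pdLE_zero_iff.1 hM
    exact ⟨_, .of_projective 𝒮 M⟩
  | succ r ih =>
    obtain ⟨n, p, hp⟩ := Module.Finite.exists_fin' R M
    obtain ⟨y, hy⟩ := ih ((isSES_ker hp).pdLE_left (pdLE_of_projective r) hM)
    exact ⟨_, .of_resolution (isSES_ker hp) hy⟩

variable [∀ i, IsNoetherian (Module.End R (𝒮.S i)) (𝒮.S i)]

variable (𝒮 P Q) in
theorem topRank_prod [Module.Finite R P] [Module.Finite R Q] :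
    𝒮.topRank (P × Q) = 𝒮.topRank P + 𝒮.topRank Q := by
  classical
  funext i
  have := isNoetherian_hom (R := R) P (𝒮.S i)
  have := isNoetherian_hom (R := R) Q (𝒮.S i)
  have h := (LinearMap.coprodEquiv (Module.End R (𝒮.S i)) (R := R) (M := P) (M₂ := Q)
    (M₃ := 𝒮.S i)).finrank_eq
  rw [Module.finrank_prod] at h
  simp only [topRank, ← h, Nat.cast_add, Pi.add_apply]

namespace HasEuler

theorem middle {α : A →ₗ[R] B} {β : B →ₗ[R] C} (h : IsSES α β) (hA : 𝒮.HasEuler A x)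
    (hC : 𝒮.HasEuler C y) : 𝒮.HasEuler B (x + y) := by
  induction hA generalizing B C y with
  | of_subsingleton =>
    have hβ : Function.Injective β := (injective_iff_map_eq_zero β).2 fun b hb ↦ by
      obtain ⟨a, rfl⟩ := (h.exact b).1 hb
      rw [Subsingleton.elim a 0, map_zero]
    rw [zero_add]
    exact hC.congr (LinearEquiv.ofBijective β ⟨hβ, h.surjective⟩).symm
  | of_resolution hip hK ih =>
    cases hC with
    | of_subsingleton =>
      have hα : Function.Surjective α := fun b ↦ (h.exact b).1 (Subsingleton.elim _ _)
      rw [add_zero]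
      exact (of_resolution hip hK).congr (LinearEquiv.ofBijective α ⟨h.injective, hα⟩)
    | of_resolution hip' hK' =>
      obtain ⟨π, φ, ψ, hπ, hφψ⟩ := h.exists_isSES_horseshoe_projective hip hip'
      rw [sub_add_sub_comm, ← topRank_prod]
      exact .of_resolution (isSES_ker hπ) (ih hφψ hK')

theorem eq_topRank [hP : Module.Projective R P] (h : 𝒮.HasEuler P x) : x = 𝒮.topRank P := by
  revert hP
  induction h with
  | of_subsingleton => exact (topRank_of_subsingleton 𝒮).symm
  | @of_resolution K F P _ _ _ _ _ _ _ _ _ p _ hip _ ih =>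
    intro hP
    obtain ⟨e⟩ := hip.nonempty_equiv_prod_of_projective
    have : Module.Projective R K :=
      pdLE_zero_iff.1 (pdLE_prod_iff.1 ((pdLE_of_projective 0).congr e)).1
    have : Module.Finite R (K × P) := .equiv e
    have : Module.Finite R K := .of_surjective (.fst R K P) LinearMap.fst_surjective
    have : Module.Finite R P := .of_surjective p hip.surjective
    rw [ih, 𝒮.topRank_congr e, topRank_prod, add_sub_cancel_left]

theorem right_of_projective {f : P →ₗ[R] B} {g : B →ₗ[R] C} (h : IsSES f g)
    [Module.Projective R P] [Module.Finite R P] (hB : 𝒮.HasEuler B x) :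
    𝒮.HasEuler C (x - 𝒮.topRank P) := by
  cases hB with
  | of_subsingleton =>
    have : Subsingleton P := h.injective.subsingleton
    have : Subsingleton C := h.surjective.subsingleton
    rw [topRank_of_subsingleton, sub_zero]
    exact .of_subsingleton C
  | of_resolution hip hK =>
    have hs := isSES_ker (g := g ∘ₗ _) (h.surjective.comp hip.surjective)
    obtain ⟨φ, ψ, hφψ⟩ := hip.exists_isSES_ker_comp h hs
    rw [sub_sub]
    exact .of_resolution hs (middle hφψ hK (.of_projective 𝒮 P))

theorem left_of_isSES {f : M →ₗ[R] E} {g : E →ₗ[R] N} (h : IsSES f g) (hE : 𝒮.HasEuler E x)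
    (hN : 𝒮.HasEuler N y) : 𝒮.HasEuler M (x - y) := by
  cases hN with
  | of_subsingleton =>
    have hf : Function.Surjective f := fun e ↦ (h.exact e).1 (Subsingleton.elim _ _)
    rw [sub_zero]
    exact hE.congr (LinearEquiv.ofBijective f ⟨h.injective, hf⟩).symm
  | @of_resolution K P _ _ _ _ _ _ _ _ _ _ p y hip hK =>
    obtain ⟨σ, hσ⟩ := Module.projective_lifting_property g p h.surjective
    obtain ⟨φ, hφ⟩ := h.exists_isSES_pullback hip hσ
    rw [show x - (𝒮.topRank P - y) = y + x - 𝒮.topRank P by abel]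
    exact right_of_projective isSES_inr_fst (middle hφ hK hE)

end HasEuler

end SimpleFamily

end Euler

/-! ### Envelopes of simple modules and finite global dimension -/

section Counting

theorem finite_envelope (k : Type v) [CommRing k] [IsArtinianRing k] {R : Type u} [Ring R]
    [Algebra k R] [Module.Finite k R] (M : ModuleCat.{u} R) [Module.Finite R M] :
    Module.Finite R (envelope M) :=
  (isEssential_range_toEnvelope M).finite k
    (Module.Finite.iff_fg.1 (Module.Finite.range (toEnvelope M)))

variable {R : Type u} [Ring R]

theorem pdLE_of_injective_of_coresLE {E : Type u} [AddCommGroup E] [Module R E]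
    [Module.Injective R E] {s : ℕ} (h : CoresLE R 1 s E) : PdLE R s E :=
  (h.of_isEssential (N := PUnit) isSES_id_zero fun L hL ↦ by simpa using hL).1

theorem idLE_of_projective {d : ℕ} (hd : IdLE R d R) (P : Type u) [AddCommGroup P] [Module R P]
    [Module.Projective R P] [Module.Finite R P] : IdLE R d P := by
  obtain ⟨n, p, hp⟩ := Module.Finite.exists_fin' R P
  let p' : (ULift.{u} (Fin n) → R) →ₗ[R] P :=
    p ∘ₗ (LinearEquiv.funCongrLeft R R Equiv.ulift.symm).toLinearMap
  obtain ⟨s, hs⟩ := Module.projective_lifting_property p' LinearMap.id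
    (hp.comp (LinearEquiv.surjective _))
  exact (IdLE.pi fun _ ↦ hd).retract hs

namespace SimpleFamily

variable {ι : Type} (𝒮 : SimpleFamily R ι)

instance (i : ι) : Nontrivial (envelope (𝒮.S i)) :=
  have := IsSimpleModule.nontrivial R (𝒮.S i)
  (toEnvelope_injective (𝒮.S i)).nontrivial

theorem exists_isSES_envelope (E : Type u) [AddCommGroup E] [Module R E] [IsArtinian R E]
    [Nontrivial E] [Module.Injective R E] :
    ∃ (i : ι) (j : envelope (𝒮.S i) →ₗ[R] E), IsSES j (LinearMap.range j).mkQ := by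
  obtain ⟨a, ha⟩ := IsAtomic.exists_atom (Submodule R E)
  have := isSimpleModule_iff_isAtom.2 ha
  obtain ⟨i, ⟨e⟩⟩ := 𝒮.exists_equiv a
  obtain ⟨j, hj⟩ := Module.Injective.extension_property R E (𝒮.S i) _ _
    (toEnvelope_injective (𝒮.S i)) (a.subtype ∘ₗ e.toLinearMap)
  refine ⟨i, j, isSES_range ((isEssential_range_toEnvelope (𝒮.S i)).injective ?_)⟩
  rintro _ ⟨x, rfl⟩ hx
  have hex : (e x : E) = 0 := (LinearMap.congr_fun hj x).symm.trans hx
  rw [e.map_eq_zero_iff.1 (Subtype.ext hex), map_zero]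

theorem injective_induction
    {motive : ∀ (E : Type u) [AddCommGroup E] [Module R E], Prop}
    (zero : ∀ (E : Type u) [AddCommGroup E] [Module R E] [Subsingleton E], motive E)
    (step : ∀ (i : ι) (E E' : Type u) [AddCommGroup E] [Module R E] [AddCommGroup E']
      [Module R E'] (j : envelope (𝒮.S i) →ₗ[R] E) (q : E →ₗ[R] E'), IsSES j q → motive E' →
      motive E)
    (E : Type u) [AddCommGroup E] [Module R E] [IsNoetherian R E] [IsArtinian R E]
    [Module.Injective R E] : motive E := by
  obtain ⟨n, hn⟩ := ENat.ne_top_iff_exists.1 (Module.length_ne_top (R := R) (M := E))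
  replace hn := hn.ge
  induction n generalizing E with
  | zero =>
    have : Subsingleton E := Module.length_eq_zero_iff.1 (le_bot_iff.1 hn)
    exact zero E
  | succ n ih =>
    rcases subsingleton_or_nontrivial E with _ | _
    · exact zero E
    obtain ⟨i, j, hj⟩ := 𝒮.exists_isSES_envelope E
    obtain ⟨e⟩ := hj.nonempty_equiv_prod_of_injective
    have := (injective_prod_iff.1 (idLE_zero_iff.1 ((idLE_of_injective 0).congr e))).2
    refine step i E _ j _ hj (ih _ ?_)
    have hlength := Module.length_eq_add_of_exact j _ hj.injective hj.surjective hj.exact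
    have hpos : 1 ≤ Module.length R (envelope (𝒮.S i)) :=
      Order.one_le_iff_pos.2 Module.length_pos
    refine (ENat.add_le_add_iff_left ENat.one_ne_top).1 ?_
    calc 1 + Module.length R (E ⧸ LinearMap.range j)
        ≤ Module.length R (envelope (𝒮.S i)) + Module.length R (E ⧸ LinearMap.range j) := by gcongr
      _ = Module.length R E := hlength.symm
      _ ≤ 1 + n := by rwa [add_comm, ← Nat.cast_succ]

theorem exists_projective_topRank_eq_smul_single [IsArtinianRing R] [DecidableEq ι]
    [∀ i, IsNoetherian (Module.End R (𝒮.S i)) (𝒮.S i)] (i : ι) :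
    ∃ (P : Type u) (_ : AddCommGroup P) (_ : Module R P), Module.Projective R P ∧
      Module.Finite R P ∧ ∃ c : ℚ, c ≠ 0 ∧ 𝒮.topRank P = c • Pi.single i 1 := by
  classical
  obtain ⟨P, _, _, hP, hPfin, hzero, f, hf⟩ := 𝒮.exists_projective i
  have := isNoetherian_hom (R := R) P (𝒮.S i)
  have : Nontrivial (P →ₗ[R] 𝒮.S i) := ⟨f, 0, hf⟩
  have hpos : 0 < Module.finrank (Module.End R (𝒮.S i)) (P →ₗ[R] 𝒮.S i) := Module.finrank_pos
  refine ⟨P, _, _, hP, hPfin, 𝒮.topRank P i, Nat.cast_ne_zero.2 hpos.ne', funext fun j ↦ ?_⟩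
  rcases eq_or_ne j i with rfl | hj
  · rw [Pi.smul_apply, Pi.single_eq_same, smul_eq_mul, mul_one]
  · have : Subsingleton (P →ₗ[R] 𝒮.S j) := ⟨fun f g ↦ by rw [hzero j hj f, hzero j hj g]⟩
    rw [Pi.smul_apply, Pi.single_eq_of_ne hj, smul_zero, topRank,
      Module.finrank_zero_of_subsingleton, Nat.cast_zero]

section Span

variable {𝒮} {V : Submodule ℚ (ι → ℚ)} [∀ i, IsNoetherian (Module.End R (𝒮.S i)) (𝒮.S i)]

theorem exists_mem_hasEuler_of_injective
    (hV : ∀ i r, PdLE R r (envelope (𝒮.S i)) → ∃ x ∈ V, 𝒮.HasEuler (envelope (𝒮.S i)) x)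
    (E : Type u) [AddCommGroup E] [Module R E] [IsNoetherian R E] [IsArtinian R E]
    [Module.Injective R E] {s : ℕ} (hs : PdLE R s E) : ∃ x ∈ V, 𝒮.HasEuler E x := by
  refine 𝒮.injective_induction (motive := fun E _ _ ↦ PdLE R s E → ∃ x ∈ V, 𝒮.HasEuler E x)
    (fun E _ _ _ _ ↦ ⟨0, V.zero_mem, .of_subsingleton E⟩) ?_ E hs
  intro i E E' _ _ _ _ j q hjq ih hE
  obtain ⟨e⟩ := hjq.nonempty_equiv_prod_of_injective
  obtain ⟨hpd, hpd'⟩ := pdLE_prod_iff.1 (hE.congr e)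
  obtain ⟨x, hx, hx'⟩ := hV i s hpd
  obtain ⟨y, hy, hy'⟩ := ih hpd'
  exact ⟨x + y, V.add_mem hx hy, .middle hjq hx' hy'⟩

theorem exists_mem_hasEuler_of_idLE (k : Type v) [CommRing k] [IsArtinianRing k] [Algebra k R]
    [Module.Finite k R]
    (hV : ∀ i r, PdLE R r (envelope (𝒮.S i)) → ∃ x ∈ V, 𝒮.HasEuler (envelope (𝒮.S i)) x)
    {N : Type u} [AddCommGroup N] [Module R N] [Module.Finite R N] {d s : ℕ} (hd : IdLE R d N)
    (hN : ∀ n, CoresLE R n s N) : ∃ x ∈ V, 𝒮.HasEuler N x := by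
  have : IsArtinianRing R := .of_finite k R
  induction d generalizing s N with
  | zero =>
    have := idLE_zero_iff.1 hd
    exact exists_mem_hasEuler_of_injective hV N (pdLE_of_injective_of_coresLE (hN 1))
  | succ d ih =>
    have := finite_envelope k (ModuleCat.of R N)
    have hs := isSES_range (toEnvelope_injective (ModuleCat.of R N))
    have henv n := (hN (n + 1)).of_isEssential hs (isEssential_range_toEnvelope _)
    obtain ⟨x, hx, hx'⟩ := exists_mem_hasEuler_of_injective hV _ (henv 0).1
    obtain ⟨y, hy, hy'⟩ := ih (hs.idLE_right hd (idLE_of_injective d)) fun n ↦ (henv n).2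
    exact ⟨x - y, V.sub_mem hx hy, .left_of_isSES hs hx' hy'⟩

theorem eq_top_of_forall_exists_mem_hasEuler (k : Type v) [CommRing k] [IsArtinianRing k]
    [Algebra k R] [Module.Finite k R] [Finite ι] (hR : ∀ n, CoresLE R n 0 R) {d : ℕ}
    (hd : IdLE R d R)
    (hV : ∀ i r, PdLE R r (envelope (𝒮.S i)) → ∃ x ∈ V, 𝒮.HasEuler (envelope (𝒮.S i)) x) :
    V = ⊤ := by
  classical
  have := Fintype.ofFinite ι
  have : IsArtinianRing R := .of_finite k R
  rw [eq_top_iff, ← (Pi.basisFun ℚ ι).span_eq, Submodule.span_le]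
  rintro _ ⟨i, rfl⟩
  obtain ⟨P, _, _, _, _, c, hc, hP⟩ := 𝒮.exists_projective_topRank_eq_smul_single i
  obtain ⟨x, hx, hx'⟩ := exists_mem_hasEuler_of_idLE k hV (idLE_of_projective hd P)
    fun n ↦ .of_projective hR n
  rw [hx'.eq_topRank, hP] at hx
  rw [Pi.basisFun_apply]
  exact (V.smul_mem_iff hc).1 hx

end Span

theorem exists_pdLE_envelope (k : Type v) [CommRing k] [IsArtinianRing k] [Algebra k R]
    [Module.Finite k R] [Finite ι] (hR : ∀ n, CoresLE R n 0 R) {d : ℕ} (hd : IdLE R d R) (i : ι) :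
    ∃ r, PdLE R r (envelope (𝒮.S i)) := by
  classical
  have := Fintype.ofFinite ι
  have : IsArtinianRing R := .of_finite k R
  have (i : ι) : IsNoetherian (Module.End R (𝒮.S i)) (𝒮.S i) := isNoetherian_end k _
  have (i : ι) : Module.Finite R (envelope (𝒮.S i)) := finite_envelope k _
  let I := {i : ι // ∃ r, PdLE R r (envelope (𝒮.S i))}
  choose x hx using fun i : I ↦ exists_hasEuler (𝒮 := 𝒮) i.2.choose_spec
  have hV : Submodule.span ℚ (Set.range x) = ⊤ :=
    eq_top_of_forall_exists_mem_hasEuler k hR hd fun i r hr ↦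
      ⟨x ⟨i, r, hr⟩, Submodule.subset_span ⟨_, rfl⟩, hx ⟨i, r, hr⟩⟩
  by_contra hi
  have hlt : Fintype.card I < Fintype.card ι := Fintype.card_subtype_lt hi
  have hle : Module.finrank ℚ (Submodule.span ℚ (Set.range x)) ≤ Fintype.card I :=
    finrank_range_le_card x
  rw [hV, finrank_top, Module.finrank_fintype_fun_eq_card] at hle
  exact hlt.not_ge hle

end SimpleFamily

theorem pdLE_of_forall_coresLE [IsNoetherianRing R] (hR : ∀ n, CoresLE R n 0 R)
    (hproj : ∀ (L : Type u) [AddCommGroup L] [Module R L] [Module.Finite R L],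
      (∀ n, CoresLE R n 0 L) → Module.Projective R L) {s : ℕ} {M : Type u} [AddCommGroup M]
    [Module R M] [Module.Finite R M] (hM : ∀ n, CoresLE R n s M) : PdLE R s M := by
  induction s generalizing M with
  | zero => exact pdLE_zero_iff.2 (hproj M hM)
  | succ s ih =>
    obtain ⟨n, p, hp⟩ := Module.Finite.exists_fin' R M
    refine (isSES_ker hp).pdLE_right (ih fun n ↦ ?_) (pdLE_of_projective _)
    cases n with
    | zero => trivial
    | succ n => exact .left (isSES_ker hp) ((CoresLE.of_projective hR _).mono s.zero_le) (hM n)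

theorem pdLE_of_pdLE_quotient_jacobson [IsSemiprimaryRing R] {D : ℕ}
    (hD : PdLE R D (R ⧸ Ring.jacobson R)) (M : Type u) [AddCommGroup M] [Module R M] :
    PdLE R D M := by
  refine IsSemiprimaryRing.induction R R M (P := fun M ↦ PdLE R D M)
    (fun M _ _ _ _ _ hJ ↦ ?_) fun M _ _ _ _ hs hq ↦ (isSES_mkQ _).pdLE_middle hs hq
  choose φ hφ using exists_hom_quotient (I := Ring.jacobson R) (M := M) fun r hr ↦
    Module.mem_annihilator.2 fun m ↦ @hJ m ⟨r, hr⟩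
  have hsurj : Function.Surjective (Finsupp.lsum ℕ φ) := fun m ↦
    ⟨Finsupp.single m (Submodule.Quotient.mk 1),
      by rw [Finsupp.lsum_single, hφ, one_smul]⟩
  have := isSemisimpleModule_quotient_of_jacobson_le (le_refl (Ring.jacobson R))
  obtain ⟨i, hi⟩ := IsSemisimpleModule.lifting_property _ hsurj LinearMap.id
  exact (hD.finsupp M).retract hi

end Counting

/-! ### Auslander-regular Artin algebras -/

section Equivalence

variable {R : Type u} [Ring R] {s : ℕ}

theorem projDimLEClass_iff {M : ModuleCat.{u} R} : projDimLEClass R s M ↔ PdLE R s M :=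
  projectiveDimension_le_iff M s

theorem globalDimension_le_iff {g : ℕ} :
    globalDimension R ≤ g ↔ ∀ (X : Type u) [AddCommGroup X] [Module R X], PdLE R g X :=
  iSup_le_iff.trans ⟨fun h X _ _ ↦ projDimLEClass_iff.1 (h (ModuleCat.of R X)),
    fun h M ↦ projDimLEClass_iff.2 (h M)⟩

theorem globalDimension_lt_top_iff :
    globalDimension R < ⊤ ↔
      ∃ g : ℕ, ∀ (X : Type u) [AddCommGroup X] [Module R X], PdLE R g X := by
  simp only [← globalDimension_le_iff]
  refine ⟨fun h ↦ ?_, fun ⟨g, hg⟩ ↦ hg.trans_lt (WithBot.coe_lt_coe.2 (ENat.natCast_lt_top g))⟩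
  generalize globalDimension R = a at h
  cases a with
  | bot => exact ⟨0, bot_le⟩
  | coe a =>
    obtain ⟨g, rfl⟩ := ENat.ne_top_iff_exists.1 (WithBot.coe_lt_coe.1 h).ne
    exact ⟨g, le_rfl⟩

theorem coresLE_of_forall_injective_pdLE (k : Type v) [CommRing k] [IsArtinianRing k] [Algebra k R]
    [Module.Finite k R] {D : ℕ} (hD : ∀ (E : Type u) [AddCommGroup E] [Module R E]
      [Module.Finite R E] [Module.Injective R E], PdLE R D E) (n : ℕ) (hs : D ≤ s) (M : Type u)
    [AddCommGroup M] [Module R M] [Module.Finite R M] : CoresLE R n s M := by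
  induction n generalizing s M with
  | zero => trivial
  | succ n ih =>
    have := finite_envelope k (ModuleCat.of R M)
    exact ⟨_, _, _, _, _, _, _, _, injective_envelope _, (hD _).mono hs,
      isSES_range (toEnvelope_injective (ModuleCat.of R M)), ih (hs.trans s.le_succ) _⟩

theorem exists_forall_pdLE (k : Type v) [CommRing k] [IsArtinianRing k] [Algebra k R]
    [Module.Finite k R] (hR : ∀ n, CoresLE R n 0 R)
    (hproj : ∀ (L : Type u) [AddCommGroup L] [Module R L] [Module.Finite R L],
      (∀ n, CoresLE R n 0 L) → Module.Projective R L) :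
    ∃ D : ℕ, ∀ (X : Type u) [AddCommGroup X] [Module R X], PdLE R D X := by
  have : IsArtinianRing R := .of_finite k R
  have : Module.Finite k Rᵐᵒᵖ := .equiv (MulOpposite.opLinearEquiv k)
  have : IsNoetherianRing Rᵐᵒᵖ := .of_finite k Rᵐᵒᵖ
  obtain ⟨d, hd⟩ := exists_idLE_self hR hproj
  obtain ⟨ι, _, ⟨𝒮⟩⟩ := exists_simpleFamily R
  have := Fintype.ofFinite ι
  choose r hr using 𝒮.exists_pdLE_envelope k hR hd
  have hinj (E : Type u) [AddCommGroup E] [Module R E] [Module.Finite R E]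
      [Module.Injective R E] : PdLE R (Finset.univ.sup r) E :=
    𝒮.injective_induction (motive := fun E _ _ ↦ PdLE R (Finset.univ.sup r) E)
      (fun _ _ _ _ ↦ pdLE_of_projective _)
      (fun i _ _ _ _ _ _ _ _ h ih ↦
        h.pdLE_middle ((hr i).mono (Finset.le_sup (Finset.mem_univ i))) ih) E
  exact ⟨_, pdLE_of_pdLE_quotient_jacobson <| pdLE_of_forall_coresLE hR hproj fun n ↦
    coresLE_of_forall_injective_pdLE k hinj n le_rfl _⟩

theorem IsAuslanderRegular.gInftyClass_eq [IsSemiprimaryRing R] (h : IsAuslanderRegular R)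
    (s : ℕ) : gInftyClass R s = projDimLEClass R s := by
  have := h.noetherian_left
  obtain ⟨g, hg⟩ := globalDimension_lt_top_iff.1 h.gldim_lt_top
  have hR : ∀ n, CoresLE R n 0 R := gInftyClass_iff.1 h.auslander
  ext M
  rw [gInftyClass_iff, projDimLEClass_iff]
  exact ⟨fun hM ↦ (hM g).pdLE hg (Nat.le_add_left g s), fun hM n ↦ .of_pdLE hR hM n⟩

theorem isAuslanderRegular_of_gInftyClass_inf_isFG_eq (k : Type v) [CommRing k] [IsArtinianRing k]
    [Algebra k R] [Module.Finite k R]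
    (h : gInftyClass R 0 ⊓ ModuleCat.isFG R = projDimLEClass R 0 ⊓ ModuleCat.isFG R) :
    IsAuslanderRegular R := by
  have : IsArtinianRing R := .of_finite k R
  have : Module.Finite k Rᵐᵒᵖ := .equiv (MulOpposite.opLinearEquiv k)
  have hmem (M : Type u) [AddCommGroup M] [Module R M] [Module.Finite R M] :
      (∀ n, CoresLE R n 0 M) ↔ Module.Projective R M := by
    have hM : ModuleCat.isFG R (ModuleCat.of R M) := ‹Module.Finite R M›
    have hiff := iff_of_eq (congrFun h (ModuleCat.of R M))
    rw [← pdLE_zero_iff]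
    simpa only [ObjectProperty.prop_inf_iff, hM, and_true, gInftyClass_iff,
      projDimLEClass_iff] using hiff
  have hR : ∀ n, CoresLE R n 0 R := (hmem R).2 inferInstance
  exact ⟨inferInstance, .of_finite k Rᵐᵒᵖ, gInftyClass_iff.2 hR, globalDimension_lt_top_iff.2 <|
    exists_forall_pdLE k hR fun L _ _ _ ↦ (hmem L).1⟩

end Equivalence

end AuslanderType

theorem theorem6p9 (k : Type v) [CommRing k] [IsArtinianRing k]
    (R : Type u) [Ring R] [Algebra k R] [Module.Finite k R] :
    List.TFAE [
      AuslanderType.IsAuslanderRegular R,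
      AuslanderType.gInftyClass R 0 = AuslanderType.projDimLEClass R 0,
      AuslanderType.gInftyClass R 0 ⊓ ModuleCat.isFG R =
        AuslanderType.projDimLEClass R 0 ⊓ ModuleCat.isFG R,
      ∀ s : ℕ, AuslanderType.gInftyClass R s = AuslanderType.projDimLEClass R s,
      ∀ s : ℕ, AuslanderType.gInftyClass R s ⊓ ModuleCat.isFG R =
        AuslanderType.projDimLEClass R s ⊓ ModuleCat.isFG R] := by
  have : IsArtinianRing R := .of_finite k R
  tfae_have 1 → 4 := fun h ↦ h.gInftyClass_eq
  tfae_have 4 → 5 := fun h s ↦ by rw [h s]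
  tfae_have 4 → 2 := fun h ↦ h 0
  tfae_have 2 → 3 := fun h ↦ by rw [h]
  tfae_have 5 → 3 := fun h ↦ h 0
  tfae_have 3 → 1 := AuslanderType.isAuslanderRegular_of_gInftyClass_inf_isFG_eq k
  tfae_finish
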